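/- For real $\mu>-\tfrac12$ let $$J_\mu(x)=\sum_{n=0}^{\infty}\frac{(-1)^n}{n!\,\Gamma(n+\mu+1)}\Big(\frac x2\Big)^{2n+\mu}$$ be the Bessel function of the first kind of order $\mu$, and put $\omega_\mu=\frac{\mu\pi}{2}+\frac{\pi}{4}$ and $\beta=\left|\mu^2-\tfrac14\right|$. Then, for every $\mu>-\tfrac12$, $$\sup_{x\ge 0}\; x^{5/2}\left|J_\mu(x)-\sqrt{\frac{2}{\pi x}}\left(\cos(x-\omega_\mu)-\Big(\mu^2-\frac14\Big)\frac{\sin(x-\omega_\mu)}{2x}\right)\right|\;\le\;\frac{\beta}{\pi}\left(\frac45\,\beta+\sqrt{\frac{2}{\pi}}\right),$$ where the expression under the supremum is read at $x=0$ as its limit as $x\to 0^+$, namely $0$. -/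

import Mathlib

/-- The Bessel function of the first kind of real order `μ`, at a real argument `x ≥ 0`:
`J_μ(x) = ∑_{n ≥ 0} (-1)^n / (n! Γ(n + μ + 1)) (x / 2)^(2 n + μ)`. -/
noncomputable def besselJ (μ x : ℝ) : ℝ :=
  ∑' n : ℕ, (-1 : ℝ) ^ n / (Nat.factorial n : ℝ) *
    ((x / 2) ^ (2 * (n : ℝ) + μ) / Real.Gamma ((n : ℝ) + μ + 1))

/-- The phase shift `ω_μ = μ π / 2 + π / 4`. -/
noncomputable def besselPhase (μ : ℝ) : ℝ :=
  μ * Real.pi / 2 + Real.pi / 4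

/-- The two-term large-argument approximation of `J_μ`:
`√(2 / (π x)) (cos (x - ω_μ) - (μ² - 1/4) sin (x - ω_μ) / (2 x))`. -/
noncomputable def besselTwoTerm (μ x : ℝ) : ℝ :=
  Real.sqrt (2 / (Real.pi * x)) *
    (Real.cos (x - besselPhase μ) -
      (μ ^ 2 - 1 / 4) * (Real.sin (x - besselPhase μ) / (2 * x)))

/-!
Put `a = μ² - 1/4`, `c = √(2/π)` and `u(x) = √x J_μ(x)`, so that `u'' + u = a u / x²`. The claim is
that `u(x)` differs from `c (cos (x - ω_μ) - a sin (x - ω_μ) / (2 x))` by at most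
`(|a| c / 4 + 289/1152 a² c) / x²` for every `x > 0`. This suffices because
`1/4 ≤ 1/π`, `289/1152 ≤ 4/(5π)` and `c ≤ 1`.

*Error bounds.* With `r = u - c cos (x - ω_μ)`, variation of constants at infinity gives
`r(x) = a ∫ₓ^∞ sin (t - x) u(t) / t² dt` (`sub_cos_eq_integral`). The essential input is the
mean-square bound `∫ₓ^∞ u² / t² ≤ c² / x` (`integral_sq_div_sq_le`). It holds for all `x > 0` and
all `μ > -1/2`, although `|u| ≤ c` fails for `μ > 1/2`; it follows from the monotonicity of the energy
`(1 - a/x²) u² + u'²` and of Sonin's function `u² + u'² / (1 - a/x²)`. Since `sin²` averages to at most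
one half against `t⁻ⁿ` (`integral_sin_sq_div_pow_le`), this yields `|r(x)| ≤ (17/24) |a| c / x`
(`abs_sub_cos_le`). Inserting `u = c cos (t - ω_μ) + r` in the integral once more produces the sine
term of the approximation, an oscillatory integral controlled by
`|∫ₓ^∞ exp (2 i t) / t² dt| ≤ 1 / (2 x²)` (`abs_integral_sin_div_sq_le`), and a remainder quadratic
in `a` (`abs_sub_two_term_le`).

*Amplitude and phase.* That `u` is asymptotic to some `A cos x + B sin x` is general
(`exists_asymptotics`). To find `A` and `B`, consider the Laplace transform `F(s)` of `x ^ μ J_μ(x)`. By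
the Bessel equation `(1 + s²) F' + (2 μ + 1) s F = 0`, so `F` is a multiple of
`(1 + s²) ^ (-(μ + 1/2))`; on the half line `s = ε + i`, `ε > 0`, the constant is read off as `ε → ∞`
(`rpow_mul_cpow_mul_besselLaplace`). As `ε → 0` an Abelian argument expresses the blow-up of `F`
through `A - i B` (`tendsto_rpow_mul_besselLaplace_zero`). Comparison and Legendre's duplication
formula give `A = c cos ω_μ`, `B = c sin ω_μ` (`tendsto_besselLiouville_sub_cos`).
-/

open Filter Topology Set MeasureTheory

/-! ### The power series and the Bessel equation -/

/-- The entire function `E_μ(z) = ∑ (-z)ⁿ / (n! Γ(n + μ + 1))`, restricted to the real line. It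
carries the power series of the Bessel function: `J_μ(x) = (x / 2)^μ E_μ(x² / 4)`. -/
noncomputable def besselEntire (μ z : ℝ) : ℝ :=
  ∑' n : ℕ, (-z) ^ n / (n.factorial : ℝ) / Real.Gamma (n + μ + 1)

lemma inv_Gamma_nat_add_le {μ : ℝ} (hμ : -(1 / 2 : ℝ) < μ) (n : ℕ) :
    1 / Real.Gamma (n + μ + 1) ≤ 1 / Real.Gamma (μ + 1) * 2 ^ n := by
  induction n with
  | zero => simp
  | succ k ih =>
    have hk : (0 : ℝ) ≤ k := k.cast_nonneg
    have hpos : 0 < (k : ℝ) + μ + 1 := by linarith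
    have h1 : Real.Gamma (((k + 1 : ℕ) : ℝ) + μ + 1) = (k + μ + 1) * Real.Gamma (k + μ + 1) := by
      rw [← Real.Gamma_add_one hpos.ne']
      push_cast
      ring_nf
    have hG : 0 < Real.Gamma (k + μ + 1) := Real.Gamma_pos_of_pos hpos
    have h2 : 1 / ((k : ℝ) + μ + 1) ≤ 2 := by
      rw [div_le_iff₀ hpos]
      linarith
    calc 1 / Real.Gamma (((k + 1 : ℕ) : ℝ) + μ + 1)
        = 1 / (k + μ + 1) * (1 / Real.Gamma (k + μ + 1)) := by rw [h1]; field_simp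
      _ ≤ 2 * (1 / Real.Gamma (μ + 1) * 2 ^ k) := by gcongr
      _ = _ := by ring

lemma abs_besselEntire_term_le {μ : ℝ} (hμ : -(1 / 2 : ℝ) < μ) (n : ℕ) {z R : ℝ} (hz : |z| ≤ R) :
    |(-z) ^ n / (n.factorial : ℝ) / Real.Gamma (n + μ + 1)| ≤
      1 / Real.Gamma (μ + 1) * ((2 * R) ^ n / n.factorial) := by
  have hn : (0 : ℝ) ≤ n := n.cast_nonneg
  have hR : 0 ≤ R := (abs_nonneg z).trans hz
  have hG : 0 < Real.Gamma (n + μ + 1) := Real.Gamma_pos_of_pos (by linarith)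
  rw [abs_div, abs_div, abs_pow, abs_neg, abs_of_pos hG, Nat.abs_cast, div_eq_mul_one_div]
  calc |z| ^ n / (n.factorial : ℝ) * (1 / Real.Gamma (n + μ + 1))
      ≤ R ^ n / (n.factorial : ℝ) * (1 / Real.Gamma (μ + 1) * 2 ^ n) := by
        have := inv_Gamma_nat_add_le hμ n
        gcongr
    _ = _ := by rw [mul_pow]; ring

lemma summable_besselEntire {μ : ℝ} (hμ : -(1 / 2 : ℝ) < μ) (z : ℝ) :
    Summable fun n : ℕ => (-z) ^ n / (n.factorial : ℝ) / Real.Gamma (n + μ + 1) :=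
  Summable.of_norm_bounded ((Real.summable_pow_div_factorial (2 * |z|)).mul_left _)
    fun n => abs_besselEntire_term_le hμ n le_rfl

lemma hasDerivAt_besselEntire {μ : ℝ} (hμ : -(1 / 2 : ℝ) < μ) (z : ℝ) :
    HasDerivAt (besselEntire μ) (-besselEntire (μ + 1) z) z := by
  set R : ℝ := |z| + 1
  set F : ℕ → ℝ → ℝ := fun n y =>
    n * (-y) ^ (n - 1) * (-1) / (n.factorial : ℝ) / Real.Gamma (n + μ + 1)
  have hshift : ∀ (n : ℕ) (y : ℝ), F (n + 1) y =
      -((-y) ^ n / (n.factorial : ℝ) / Real.Gamma (n + (μ + 1) + 1)) := by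
    intro n y
    have h1 : ((n + 1 : ℕ) : ℝ) + μ + 1 = n + (μ + 1) + 1 := by push_cast; ring
    have h2 : ((n : ℝ) + 1) ≠ 0 := by positivity
    simp only [F, Nat.add_sub_cancel, h1, Nat.factorial_succ]
    push_cast
    field_simp
  set u : ℕ → ℝ := fun n => Nat.casesOn n 0 fun k =>
    1 / Real.Gamma (μ + 1 + 1) * ((2 * R) ^ k / k.factorial)
  have hu : Summable u :=
    (summable_nat_add_iff 1).mp ((Real.summable_pow_div_factorial (2 * R)).mul_left _)
  have hder : HasDerivAt (besselEntire μ) (∑' n, F n z) z := by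
    refine hasDerivAt_tsum_of_isPreconnected (t := Metric.ball 0 R) (y₀ := z) hu Metric.isOpen_ball
      (convex_ball _ _).isPreconnected ?_ ?_ ?_ (summable_besselEntire hμ z) ?_
    · intro n y _
      exact (((hasDerivAt_id y).neg.pow n).div_const _).div_const _
    · intro n y hy
      rcases n with _ | k
      · simp [F, u]
      · rw [hshift, norm_neg]
        refine abs_besselEntire_term_le (by linarith) k ?_
        simpa using (mem_ball_zero_iff.mp hy).le
    · simp [R]
    · simp [R]
  have hsum : Summable fun n => F n z :=
    (summable_nat_add_iff 1).mp (by
      simpa only [hshift] using (summable_besselEntire (by linarith : -(1 / 2 : ℝ) < μ + 1) z).neg)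
  have h0 : F 0 z = 0 := by simp [F]
  rw [hsum.tsum_eq_zero_add, h0, zero_add] at hder
  simpa only [hshift, tsum_neg, ← besselEntire.eq_def] using hder

/-- The contiguous relation of the series; it is the Bessel equation once the derivatives are
expressed by `hasDerivAt_besselEntire`. -/
lemma besselEntire_recurrence {μ : ℝ} (hμ : -(1 / 2 : ℝ) < μ) (z : ℝ) :
    besselEntire μ z = (μ + 1) * besselEntire (μ + 1) z - z * besselEntire (μ + 2) z := by
  have h1 := summable_besselEntire (by linarith : -(1 / 2 : ℝ) < μ + 1) z
  have h2 := summable_besselEntire (by linarith : -(1 / 2 : ℝ) < μ + 2) z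
  have hG : ∀ n : ℕ, Real.Gamma (n + (μ + 1) + 1) = (n + μ + 1) * Real.Gamma (n + μ + 1) := by
    intro n
    have hn : (0 : ℝ) ≤ n := n.cast_nonneg
    rw [← Real.Gamma_add_one (by linarith)]
    ring_nf
  have hne : ∀ n : ℕ, (n : ℝ) + μ + 1 ≠ 0 ∧ Real.Gamma (n + μ + 1) ≠ 0 := by
    intro n
    have hn : (0 : ℝ) ≤ n := n.cast_nonneg
    have : 0 < (n : ℝ) + μ + 1 := by linarith
    exact ⟨this.ne', (Real.Gamma_pos_of_pos this).ne'⟩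
  set v : ℕ → ℝ := fun n =>
    n * ((-z) ^ n / (n.factorial : ℝ) / Real.Gamma (n + (μ + 1) + 1))
  have hv : ∀ n : ℕ, v (n + 1) =
      -z * ((-z) ^ n / (n.factorial : ℝ) / Real.Gamma (n + (μ + 2) + 1)) := by
    intro n
    have e : ((n + 1 : ℕ) : ℝ) + (μ + 1) + 1 = n + (μ + 2) + 1 := by push_cast; ring
    have h2 : ((n : ℝ) + 1) ≠ 0 := by positivity
    simp only [v, e, Nat.factorial_succ, pow_succ]
    push_cast
    field_simp
  have hvs : Summable v := (summable_nat_add_iff 1).mp (by simpa only [hv] using h2.mul_left (-z))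
  have hvt : ∑' n, v n = -z * besselEntire (μ + 2) z := by
    rw [hvs.tsum_eq_zero_add]
    simp only [hv, tsum_mul_left]
    simp [v, besselEntire]
  have : besselEntire μ z = (μ + 1) * besselEntire (μ + 1) z + ∑' n, v n := by
    unfold besselEntire
    rw [← tsum_mul_left, ← (h1.mul_left _).tsum_add hvs]
    refine tsum_congr fun n => ?_
    obtain ⟨ha, hb⟩ := hne n
    simp only [v, hG]
    field_simp
    ring
  rw [this, hvt]
  ring

/-- The even entire factor `g_μ` of the Bessel function: `J_μ(x) = x^μ g_μ(x)` for `x > 0`. -/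
noncomputable def besselEven (μ x : ℝ) : ℝ := 2 ^ (-μ) * besselEntire μ (x ^ 2 / 4)

/-- The derivative of `besselEven`. -/
noncomputable def besselEvenDeriv (μ x : ℝ) : ℝ :=
  -(2 ^ (-μ) * (x / 2) * besselEntire (μ + 1) (x ^ 2 / 4))

lemma hasDerivAt_sq_div_four (x : ℝ) : HasDerivAt (fun x : ℝ => x ^ 2 / 4) (x / 2) x := by
  convert! (hasDerivAt_pow 2 x).div_const 4 using 1
  norm_num [div_eq_mul_inv]
  ring

lemma hasDerivAt_besselEven {μ : ℝ} (hμ : -(1 / 2 : ℝ) < μ) (x : ℝ) :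
    HasDerivAt (besselEven μ) (besselEvenDeriv μ x) x := by
  convert! ((hasDerivAt_besselEntire hμ (x ^ 2 / 4)).comp x (hasDerivAt_sq_div_four x)).const_mul
    ((2 : ℝ) ^ (-μ)) using 1
  simp only [besselEvenDeriv]
  ring

lemma hasDerivAt_besselEvenDeriv {μ : ℝ} (hμ : -(1 / 2 : ℝ) < μ) {x : ℝ} (hx : x ≠ 0) :
    HasDerivAt (besselEvenDeriv μ)
      (-besselEven μ x - (2 * μ + 1) / x * besselEvenDeriv μ x) x := by
  have h := (hasDerivAt_besselEntire (by linarith : -(1 / 2 : ℝ) < μ + 1) (x ^ 2 / 4)).comp x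
    (hasDerivAt_sq_div_four x)
  convert! ((((hasDerivAt_id x).div_const 2).const_mul ((2 : ℝ) ^ (-μ))).mul h).neg using 1
  simp only [besselEven, besselEvenDeriv, besselEntire_recurrence hμ, id, Function.comp]
  rw [show μ + 1 + 1 = μ + 2 by ring]
  field_simp
  ring

lemma besselEven_zero (μ : ℝ) : besselEven μ 0 = 2 ^ (-μ) / Real.Gamma (μ + 1) := by
  have : besselEntire μ 0 = 1 / Real.Gamma (μ + 1) := by
    rw [besselEntire, tsum_eq_single 0 (fun n hn => by simp [hn])]
    simp
  simp [besselEven, this, div_eq_mul_inv]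

lemma besselJ_eq_rpow_mul {μ x : ℝ} (hx : 0 < x) : besselJ μ x = x ^ μ * besselEven μ x := by
  have hx2 : 0 < x / 2 := by positivity
  rw [besselJ, besselEven, besselEntire, ← tsum_mul_left, ← tsum_mul_left]
  refine tsum_congr fun n => ?_
  have h1 : (x / 2) ^ (2 * (n : ℝ) + μ) = (x ^ 2 / 4) ^ n * (x ^ μ * 2 ^ (-μ)) := by
    rw [Real.rpow_add hx2, Real.rpow_mul hx2.le, Real.rpow_two, Real.rpow_natCast, div_pow,
      Real.div_rpow hx.le (by norm_num), Real.rpow_neg (by norm_num), div_eq_mul_inv (x ^ μ)]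
    norm_num
  rw [h1, neg_pow (x ^ 2 / 4)]
  ring

/-! ### Solutions of the normal form: bounds and asymptotics -/

lemma le_of_hasDerivAt_nonneg_of_tendsto {f f' : ℝ → ℝ} {b L : ℝ}
    (hd : ∀ x > b, HasDerivAt f (f' x) x) (h0 : ∀ x > b, 0 ≤ f' x)
    (hL : Tendsto f atTop (𝓝 L)) {x : ℝ} (hx : b < x) : f x ≤ L := by
  have hm : MonotoneOn f (Ioi b) :=
    monotoneOn_of_hasDerivWithinAt_nonneg (convex_Ioi b)
      (fun y hy => (hd y hy).continuousAt.continuousWithinAt)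
      (fun y hy => (hd y (by simpa using hy)).hasDerivWithinAt)
      (fun y hy => h0 y (by simpa using hy))
  refine ge_of_tendsto hL ?_
  filter_upwards [eventually_ge_atTop x] with y hy
  exact hm hx (lt_of_lt_of_le hx hy) hy

lemma le_of_hasDerivAt_nonneg_of_tendsto_nhdsGT {f f' : ℝ → ℝ} {b L : ℝ}
    (hd : ∀ x > b, HasDerivAt f (f' x) x) (h0 : ∀ x > b, 0 ≤ f' x)
    (hL : Tendsto f (𝓝[>] b) (𝓝 L)) {x : ℝ} (hx : b < x) : L ≤ f x := by
  have hm : MonotoneOn f (Ioi b) :=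
    monotoneOn_of_hasDerivWithinAt_nonneg (convex_Ioi b)
      (fun y hy => (hd y hy).continuousAt.continuousWithinAt)
      (fun y hy => (hd y (by simpa using hy)).hasDerivWithinAt)
      (fun y hy => h0 y (by simpa using hy))
  refine le_of_tendsto hL ?_
  filter_upwards [Ioo_mem_nhdsGT hx] with y hy
  exact hm hy.1 hx hy.2.le

lemma hasDerivAt_inv_pow (n : ℕ) {x : ℝ} (hx : x ≠ 0) :
    HasDerivAt (fun t : ℝ => 1 / t ^ n) (-n / x ^ (n + 1)) x := by
  convert! (hasDerivAt_pow n x).inv (pow_ne_zero n hx) using 1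
  · funext t
    simp
  · rcases n with _ | n
    · simp
    · simp only [Nat.add_sub_cancel]
      field_simp
      ring

lemma tendsto_one_div_pow_atTop {n : ℕ} (hn : n ≠ 0) :
    Tendsto (fun t : ℝ => 1 / t ^ n) atTop (𝓝 0) := by
  simpa [Function.comp_def] using tendsto_inv_atTop_zero.comp (tendsto_pow_atTop (α := ℝ) hn)

lemma integrableOn_one_div_pow {n : ℕ} (hn : 2 ≤ n) {x : ℝ} (hx : 0 < x) :
    IntegrableOn (fun t : ℝ => 1 / t ^ n) (Ioi x) := by
  have h2 : (2 : ℝ) ≤ n := by exact_mod_cast hn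
  refine (integrableOn_Ioi_rpow_of_lt (a := -(n : ℝ)) (by linarith) hx).congr_fun ?_
    measurableSet_Ioi
  intro t ht
  have ht0 : (0 : ℝ) < t := hx.trans ht
  simp [Real.rpow_neg ht0.le]

lemma integral_one_div_sq {x : ℝ} (hx : 0 < x) : ∫ t in Ioi x, 1 / t ^ 2 = 1 / x := by
  have := integral_Ioi_of_hasDerivAt_of_tendsto' (a := x) (m := 0)
    (f := fun t : ℝ => -(1 / t ^ 1)) (f' := fun t : ℝ => 1 / t ^ 2)
    (fun t ht => by
      convert! (hasDerivAt_inv_pow 1 (hx.trans_le ht).ne').neg using 1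
      norm_num
      ring)
    (integrableOn_one_div_pow le_rfl hx)
    (by simpa using (tendsto_one_div_pow_atTop one_ne_zero).neg)
  rw [this]
  simp

lemma integral_one_div_cube {x : ℝ} (hx : 0 < x) : ∫ t in Ioi x, 1 / t ^ 3 = 1 / (2 * x ^ 2) := by
  have := integral_Ioi_of_hasDerivAt_of_tendsto' (a := x) (m := 0)
    (f := fun t : ℝ => -(1 / 2) * (1 / t ^ 2)) (f' := fun t : ℝ => 1 / t ^ 3)
    (fun t ht => by
      have ht0 : t ≠ 0 := (hx.trans_le ht).ne'
      convert! (hasDerivAt_inv_pow 2 ht0).const_mul (-(1 / 2 : ℝ)) using 1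
      norm_num
      field_simp)
    (integrableOn_one_div_pow (by norm_num) hx)
    (by simpa using (tendsto_one_div_pow_atTop two_ne_zero).const_mul (-(1 / 2 : ℝ)))
  rw [this]
  have := hx.ne'
  field_simp
  norm_num

lemma integrableOn_Ioi_of_abs_le_div_pow {f : ℝ → ℝ} {x C : ℝ} {n : ℕ} (hn : 2 ≤ n) (hx : 0 < x)
    (hf : ContinuousOn f (Ioi x)) (hb : ∀ t > x, |f t| ≤ C * (1 / t ^ n)) :
    IntegrableOn f (Ioi x) :=
  ((integrableOn_one_div_pow hn hx).const_mul C).mono'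
    (hf.aestronglyMeasurable measurableSet_Ioi)
    ((ae_restrict_iff' measurableSet_Ioi).mpr (Eventually.of_forall hb))

/-- `u` solves `u'' + (1 - a / x²) u = 0` on `(0, ∞)`, with derivative `v`. This is the normal form
of the Bessel equation: `u(x) = √x J_μ(x)` solves it with `a = μ² - 1 / 4`. -/
structure SolvesBesselNormalForm (a : ℝ) (u v : ℝ → ℝ) : Prop where
  hasDerivAt : ∀ x > 0, HasDerivAt u (v x) x
  hasDerivAt_deriv : ∀ x > 0, HasDerivAt v ((a / x ^ 2 - 1) * u x) x

namespace SolvesBesselNormalForm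

variable {a : ℝ} {u v : ℝ → ℝ}

lemma continuousOn (h : SolvesBesselNormalForm a u v) : ContinuousOn u (Ioi 0) :=
  fun x hx => (h.hasDerivAt x hx).continuousAt.continuousWithinAt

lemma continuousOn_deriv (h : SolvesBesselNormalForm a u v) : ContinuousOn v (Ioi 0) :=
  fun x hx => (h.hasDerivAt_deriv x hx).continuousAt.continuousWithinAt

/-- Gronwall's argument: `(u² + v²) exp(|a| / x)` is nonincreasing. -/
lemma exists_sq_add_sq_le (h : SolvesBesselNormalForm a u v) :
    ∃ M, ∀ x ≥ 1, u x ^ 2 + v x ^ 2 ≤ M := by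
  refine ⟨(u 1 ^ 2 + v 1 ^ 2) * Real.exp (|a| * (1 / 1 ^ 1)), fun x hx => ?_⟩
  have hanti : AntitoneOn (fun x => (u x ^ 2 + v x ^ 2) * Real.exp (|a| * (1 / x ^ 1)))
      (Ici 1) := by
    have hd : ∀ x > 0, HasDerivAt
        (fun x => (u x ^ 2 + v x ^ 2) * Real.exp (|a| * (1 / x ^ 1)))
        (-(Real.exp (|a| * (1 / x ^ 1)) / x ^ 2 *
          (|a| * (u x ^ 2 + v x ^ 2) - 2 * a * (u x * v x)))) x := by
      intro x hx
      have hx0 : x ≠ 0 := ne_of_gt hx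
      convert! (((h.hasDerivAt x hx).pow 2).add ((h.hasDerivAt_deriv x hx).pow 2)).mul
        (((hasDerivAt_inv_pow 1 hx0).const_mul |a|).exp) using 1
      simp only [Pi.add_apply, Pi.pow_apply]
      field_simp
      push_cast
      ring
    refine antitoneOn_of_hasDerivWithinAt_nonpos (convex_Ici 1)
      (fun y hy => (hd y (by linarith [mem_Ici.mp hy])).continuousAt.continuousWithinAt)
      (fun y hy => (hd y (by
        rw [interior_Ici] at hy; linarith [mem_Ioi.mp hy])).hasDerivWithinAt)
      (fun y hy => ?_)
    have h1 : 2 * a * (u y * v y) ≤ |a| * (u y ^ 2 + v y ^ 2) := by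
      refine (le_abs_self _).trans ?_
      rw [abs_mul, abs_mul, abs_two, abs_mul, ← sq_abs (u y), ← sq_abs (v y)]
      nlinarith [mul_nonneg (abs_nonneg a) (sq_nonneg (|u y| - |v y|))]
    rw [neg_nonpos]
    have : 0 ≤ |a| * (u y ^ 2 + v y ^ 2) - 2 * a * (u y * v y) := by linarith
    positivity
  refine le_trans ?_ (hanti (by simp) hx hx)
  refine le_mul_of_one_le_right (by positivity) (Real.one_le_exp ?_)
  have : (0 : ℝ) < x := by linarith
  positivity

lemma exists_abs_le (h : SolvesBesselNormalForm a u v) :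
    ∃ M, 0 ≤ M ∧ ∀ x ≥ 1, |u x| ≤ M ∧ |v x| ≤ M := by
  obtain ⟨M, hM⟩ := h.exists_sq_add_sq_le
  have h0 : 0 ≤ M := le_trans (by positivity) (hM 1 le_rfl)
  refine ⟨√M, Real.sqrt_nonneg _, fun x hx => ⟨Real.abs_le_sqrt ?_, Real.abs_le_sqrt ?_⟩⟩
  · nlinarith [hM x hx, sq_nonneg (v x)]
  · nlinarith [hM x hx, sq_nonneg (u x)]

/-- On every half line away from `0` the solution is bounded. -/
lemma exists_abs_le_of_pos (h : SolvesBesselNormalForm a u v) {x : ℝ} (hx : 0 < x) :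
    ∃ M, 0 ≤ M ∧ ∀ t ≥ x, |u t| ≤ M ∧ |v t| ≤ M := by
  obtain ⟨M, hM0, hM⟩ := h.exists_abs_le
  have hs : Icc x (max x 1) ⊆ Ioi 0 := fun t ht => hx.trans_le ht.1
  obtain ⟨C, hC⟩ := isCompact_Icc.exists_bound_of_continuousOn (h.continuousOn.mono hs)
  obtain ⟨C', hC'⟩ := isCompact_Icc.exists_bound_of_continuousOn (h.continuousOn_deriv.mono hs)
  refine ⟨max M (max C C'), le_max_of_le_left hM0, fun t ht => ?_⟩
  by_cases h1 : 1 ≤ t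
  · exact ⟨(hM t h1).1.trans (le_max_left _ _), (hM t h1).2.trans (le_max_left _ _)⟩
  · have ht' : t ∈ Icc x (max x 1) := ⟨ht, le_max_of_le_right (not_le.mp h1).le⟩
    exact ⟨(hC t ht').trans (le_max_of_le_right (le_max_left _ _)),
      (hC' t ht').trans (le_max_of_le_right (le_max_right _ _))⟩

/-- Variation of constants: the perturbation `a u / x²` is integrable at infinity, so every solution
is asymptotic to a solution of `u'' + u = 0`. -/
lemma exists_asymptotics (h : SolvesBesselNormalForm a u v) :
    ∃ A B : ℝ, Tendsto (fun x => u x - (A * Real.cos x + B * Real.sin x)) atTop (𝓝 0) ∧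
      Tendsto (fun x => v x - (B * Real.cos x - A * Real.sin x)) atTop (𝓝 0) := by
  obtain ⟨M, hM0, hM⟩ := h.exists_abs_le
  have hcont : ContinuousOn u (Ioi 1) := h.continuousOn.mono (Ioi_subset_Ioi zero_le_one)
  have hne : ∀ t ∈ Ioi (1 : ℝ), t ^ 2 ≠ 0 := fun t ht =>
    pow_ne_zero 2 (by linarith [mem_Ioi.mp ht] : (0 : ℝ) < t).ne'
  have hbound : ∀ (w : ℝ → ℝ), (∀ t, |w t| ≤ 1) → ∀ t > 1,
      |a / t ^ 2 * u t * w t| ≤ |a| * M * (1 / t ^ 2) := by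
    intro w hw t ht
    rw [abs_mul, abs_mul, abs_div, abs_of_nonneg (sq_nonneg t)]
    have := (hM t (le_of_lt ht)).1
    calc |a| / t ^ 2 * |u t| * |w t| ≤ |a| / t ^ 2 * M * 1 := by
          gcongr
          exact hw t
      _ = _ := by ring
  have hα : ∃ A, Tendsto (fun x => u x * Real.cos x - v x * Real.sin x) atTop (𝓝 A) := by
    refine ⟨_, tendsto_limUnder_of_hasDerivAt_of_integrableOn_Ioi (a := 1)
      (f' := fun t => -(a / t ^ 2 * u t * Real.sin t)) ?_ ?_⟩
    · intro t ht
      have ht0 : t > 0 := by linarith [mem_Ioi.mp ht]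
      convert! ((h.hasDerivAt t ht0).mul (Real.hasDerivAt_cos t)).sub
        ((h.hasDerivAt_deriv t ht0).mul (Real.hasDerivAt_sin t)) using 1
      ring
    · refine (integrableOn_Ioi_of_abs_le_div_pow le_rfl one_pos ?_
        (hbound _ Real.abs_sin_le_one)).neg
      exact ((continuousOn_const.div (by fun_prop) hne).mul hcont).mul (by fun_prop)
  have hβ : ∃ B, Tendsto (fun x => u x * Real.sin x + v x * Real.cos x) atTop (𝓝 B) := by
    refine ⟨_, tendsto_limUnder_of_hasDerivAt_of_integrableOn_Ioi (a := 1)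
      (f' := fun t => a / t ^ 2 * u t * Real.cos t) ?_ ?_⟩
    · intro t ht
      have ht0 : t > 0 := by linarith [mem_Ioi.mp ht]
      convert! ((h.hasDerivAt t ht0).mul (Real.hasDerivAt_sin t)).add
        ((h.hasDerivAt_deriv t ht0).mul (Real.hasDerivAt_cos t)) using 1
      ring
    · refine integrableOn_Ioi_of_abs_le_div_pow le_rfl one_pos ?_ (hbound _ Real.abs_cos_le_one)
      exact ((continuousOn_const.div (by fun_prop) hne).mul hcont).mul (by fun_prop)
  obtain ⟨A, hA⟩ := hα
  obtain ⟨B, hB⟩ := hβ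
  have hA0 := hA.sub_const A
  have hB0 := hB.sub_const B
  rw [sub_self] at hA0 hB0
  have bcos : IsBoundedUnder (· ≤ ·) atTop ((‖·‖) ∘ Real.cos) :=
    isBoundedUnder_of ⟨1, fun x => Real.abs_cos_le_one x⟩
  have bsin : IsBoundedUnder (· ≤ ·) atTop ((‖·‖) ∘ Real.sin) :=
    isBoundedUnder_of ⟨1, fun x => Real.abs_sin_le_one x⟩
  refine ⟨A, B, ?_, ?_⟩
  · convert! (hA0.zero_mul_isBoundedUnder_le bcos).add
      (hB0.zero_mul_isBoundedUnder_le bsin) using 2 with x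
    · linear_combination -u x * Real.sin_sq_add_cos_sq x
    · simp
  · convert! (hB0.zero_mul_isBoundedUnder_le bcos).sub
      (hA0.zero_mul_isBoundedUnder_le bsin) using 2 with x
    · linear_combination -v x * Real.sin_sq_add_cos_sq x
    · simp

end SolvesBesselNormalForm

/-! ### Oscillatory integrals against inverse powers -/

lemma abs_sin_mul_div_pow_le (n : ℕ) {t s : ℝ} (ht : 0 < t) :
    |Real.sin s / t ^ n| ≤ 1 * (1 / t ^ n) := by
  rw [abs_div, abs_of_pos (pow_pos ht n), one_mul]
  gcongr
  exact Real.abs_sin_le_one _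

lemma abs_cos_mul_div_pow_le (n : ℕ) {t s : ℝ} (ht : 0 < t) :
    |Real.cos s / t ^ n| ≤ 1 * (1 / t ^ n) := by
  rw [abs_div, abs_of_pos (pow_pos ht n), one_mul]
  gcongr
  exact Real.abs_cos_le_one _

lemma continuousOn_div_pow {f : ℝ → ℝ} {x : ℝ} (n : ℕ) (hx : 0 < x) (hf : ContinuousOn f (Ioi x)) :
    ContinuousOn (fun t => f t / t ^ n) (Ioi x) :=
  hf.div (by fun_prop) fun _ ht => pow_ne_zero n (hx.trans ht).ne'

lemma integrableOn_cos_div_pow {n : ℕ} (hn : 2 ≤ n) {x : ℝ} (hx : 0 < x) (b : ℝ) :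
    IntegrableOn (fun t => Real.cos (2 * t - b) / t ^ n) (Ioi x) :=
  integrableOn_Ioi_of_abs_le_div_pow hn hx (continuousOn_div_pow n hx (by fun_prop))
    fun _ ht => abs_cos_mul_div_pow_le n (hx.trans ht)

lemma integrableOn_sin_div_pow {n : ℕ} (hn : 2 ≤ n) {x : ℝ} (hx : 0 < x) (b : ℝ) :
    IntegrableOn (fun t => Real.sin (2 * t - b) / t ^ n) (Ioi x) :=
  integrableOn_Ioi_of_abs_le_div_pow hn hx (continuousOn_div_pow n hx (by fun_prop))
    fun _ ht => abs_sin_mul_div_pow_le n (hx.trans ht)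

lemma integrableOn_sin_sq_div_pow {n : ℕ} (hn : 2 ≤ n) {x : ℝ} (hx : 0 < x) :
    IntegrableOn (fun t => Real.sin (t - x) ^ 2 / t ^ n) (Ioi x) :=
  integrableOn_Ioi_of_abs_le_div_pow hn hx (continuousOn_div_pow (f := fun t => Real.sin (t - x) ^ 2)
    n hx (by fun_prop)) (C := 1) fun t ht => by
      have ht0 : 0 < t := hx.trans ht
      rw [abs_of_nonneg (by positivity), one_mul]
      gcongr
      exact Real.sin_sq_le_one _

lemma tendsto_bounded_div_pow_atTop {f : ℝ → ℝ} {C : ℝ} (hf : ∀ t, |f t| ≤ C) {n : ℕ} (hn : n ≠ 0) :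
    Tendsto (fun t => f t / t ^ n) atTop (𝓝 0) := by
  have := (tendsto_one_div_pow_atTop hn).zero_mul_isBoundedUnder_le
    (g := f) (isBoundedUnder_of ⟨C, hf⟩)
  refine this.congr fun t => ?_
  ring

/-- The cosine transform of the convex function `t ↦ t⁻ⁿ` on `(x, ∞)` is nonnegative: two
integrations by parts turn it into a multiple of `∫ sin² (t - x) / t ^ (n + 2)`. -/
lemma integral_cos_div_pow_nonneg {n : ℕ} (hn : 2 ≤ n) {x : ℝ} (hx : 0 < x) :
    0 ≤ ∫ t in Ioi x, Real.cos (2 * t - 2 * x) / t ^ n := by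
  have hd : ∀ t ∈ Ici x, HasDerivAt
      (fun t => 1 / 2 * (Real.sin (2 * t - 2 * x) * (1 / t ^ n)) +
        n / 2 * (Real.sin (t - x) ^ 2 * (1 / t ^ (n + 1))))
      (Real.cos (2 * t - 2 * x) / t ^ n -
        n * (n + 1) / 2 * (Real.sin (t - x) ^ 2 / t ^ (n + 2))) t := by
    intro t ht
    have ht0 : t ≠ 0 := (hx.trans_le ht).ne'
    have h1 : HasDerivAt (fun t => Real.sin (2 * t - 2 * x)) (Real.cos (2 * t - 2 * x) * 2) t := by
      simpa using (((hasDerivAt_id t).const_mul 2).sub_const (2 * x)).sin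
    have h2 : HasDerivAt (fun t => Real.sin (t - x) ^ 2)
        (2 * Real.sin (t - x) * Real.cos (t - x)) t := by
      convert! (((hasDerivAt_id t).sub_const x).sin).pow 2 using 1
      simp
    convert! ((h1.mul (hasDerivAt_inv_pow n ht0)).const_mul (1 / 2 : ℝ)).add
      ((h2.mul (hasDerivAt_inv_pow (n + 1) ht0)).const_mul (n / 2 : ℝ)) using 1
    have h3 : Real.sin (2 * t - 2 * x) = 2 * Real.sin (t - x) * Real.cos (t - x) := by
      rw [← Real.sin_two_mul]
      ring_nf
    rw [h3]
    push_cast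
    field_simp
    ring
  have hI1 := integrableOn_cos_div_pow hn hx (2 * x)
  have hI2 := (integrableOn_sin_sq_div_pow (n := n + 2) (by omega) hx).const_mul
    ((n : ℝ) * (n + 1) / 2)
  have hlim : Tendsto (fun t => 1 / 2 * (Real.sin (2 * t - 2 * x) * (1 / t ^ n)) +
        n / 2 * (Real.sin (t - x) ^ 2 * (1 / t ^ (n + 1)))) atTop (𝓝 0) := by
    have l1 := tendsto_bounded_div_pow_atTop (f := fun t => Real.sin (2 * t - 2 * x))
      (fun t => Real.abs_sin_le_one _) (n := n) (by omega)
    have l2 := tendsto_bounded_div_pow_atTop (f := fun t => Real.sin (t - x) ^ 2)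
      (C := 1) (fun t => by rw [abs_of_nonneg (sq_nonneg _)]; exact Real.sin_sq_le_one _)
      (n := n + 1) (by omega)
    simpa [div_eq_mul_inv] using (l1.const_mul (1 / 2 : ℝ)).add (l2.const_mul (n / 2 : ℝ))
  have hint := integral_Ioi_of_hasDerivAt_of_tendsto' hd (hI1.sub hI2) hlim
  rw [integral_sub hI1 hI2, integral_const_mul] at hint
  have hnn : 0 ≤ ∫ t in Ioi x, Real.sin (t - x) ^ 2 / t ^ (n + 2) :=
    setIntegral_nonneg measurableSet_Ioi fun t ht => by
      have : 0 < t := hx.trans ht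
      positivity
  have h0 : (0 : ℝ) - (1 / 2 * (Real.sin (2 * x - 2 * x) * (1 / x ^ n)) +
        n / 2 * (Real.sin (x - x) ^ 2 * (1 / x ^ (n + 1)))) = 0 := by simp
  rw [h0] at hint
  have : 0 ≤ (n : ℝ) * (n + 1) / 2 * ∫ t in Ioi x, Real.sin (t - x) ^ 2 / t ^ (n + 2) := by
    positivity
  linarith

/-- Against `t⁻ⁿ` on `(x, ∞)` the function `sin² (t - x)` averages to at most one half. -/
lemma integral_sin_sq_div_pow_le {n : ℕ} (hn : 2 ≤ n) {x : ℝ} (hx : 0 < x) :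
    ∫ t in Ioi x, Real.sin (t - x) ^ 2 / t ^ n ≤ 1 / 2 * ∫ t in Ioi x, 1 / t ^ n := by
  have h := integral_cos_div_pow_nonneg hn hx
  have e : ∫ t in Ioi x, Real.sin (t - x) ^ 2 / t ^ n =
      ∫ t in Ioi x, (1 / 2 * (1 / t ^ n) - 1 / 2 * (Real.cos (2 * t - 2 * x) / t ^ n)) := by
    congr 1
    funext t
    have : Real.cos (2 * t - 2 * x) = 1 - 2 * Real.sin (t - x) ^ 2 := by
      rw [← mul_sub, Real.cos_two_mul, Real.cos_sq']
      ring
    rw [this]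
    ring
  rw [e, integral_sub ((integrableOn_one_div_pow hn hx).const_mul _)
    ((integrableOn_cos_div_pow hn hx _).const_mul _), integral_const_mul, integral_const_mul]
  linarith

lemma integral_cos_div_sq_le {x : ℝ} (hx : 0 < x) :
    ∫ t in Ioi x, Real.cos (2 * t - 2 * x) / t ^ 2 ≤ 1 / (2 * x ^ 3) := by
  have hd : ∀ t ∈ Ici x, HasDerivAt
      (fun t => 1 / 2 * (Real.sin (2 * t - 2 * x) * (1 / t ^ 2)) -
        1 / 2 * (Real.cos (2 * t - 2 * x) * (1 / t ^ 3)))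
      (Real.cos (2 * t - 2 * x) / t ^ 2 + 3 / 2 * (Real.cos (2 * t - 2 * x) / t ^ 4)) t := by
    intro t ht
    have ht0 : t ≠ 0 := (hx.trans_le ht).ne'
    have h0 := ((hasDerivAt_id t).const_mul 2).sub_const (2 * x)
    have h1 : HasDerivAt (fun t => Real.sin (2 * t - 2 * x)) (Real.cos (2 * t - 2 * x) * 2) t := by
      simpa using h0.sin
    have h2 : HasDerivAt (fun t => Real.cos (2 * t - 2 * x))
        (-Real.sin (2 * t - 2 * x) * 2) t := by
      simpa using h0.cos
    convert! ((h1.mul (hasDerivAt_inv_pow 2 ht0)).const_mul (1 / 2 : ℝ)).sub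
      ((h2.mul (hasDerivAt_inv_pow 3 ht0)).const_mul (1 / 2 : ℝ)) using 1
    push_cast
    field_simp
    ring
  have hI1 := integrableOn_cos_div_pow le_rfl hx (2 * x)
  have hI2 := (integrableOn_cos_div_pow (n := 4) (by norm_num) hx (2 * x)).const_mul (3 / 2 : ℝ)
  have hlim : Tendsto (fun t => 1 / 2 * (Real.sin (2 * t - 2 * x) * (1 / t ^ 2)) -
        1 / 2 * (Real.cos (2 * t - 2 * x) * (1 / t ^ 3))) atTop (𝓝 0) := by
    have l1 := tendsto_bounded_div_pow_atTop (f := fun t => Real.sin (2 * t - 2 * x))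
      (fun t => Real.abs_sin_le_one _) two_ne_zero
    have l2 := tendsto_bounded_div_pow_atTop (f := fun t => Real.cos (2 * t - 2 * x))
      (fun t => Real.abs_cos_le_one _) three_ne_zero
    simpa [div_eq_mul_inv] using (l1.const_mul (1 / 2 : ℝ)).sub (l2.const_mul (1 / 2 : ℝ))
  have hint := integral_Ioi_of_hasDerivAt_of_tendsto' hd (hI1.add hI2) hlim
  rw [integral_add hI1 hI2, integral_const_mul] at hint
  have hnn := integral_cos_div_pow_nonneg (n := 4) (by norm_num) hx
  have h0 : (0 : ℝ) - (1 / 2 * (Real.sin (2 * x - 2 * x) * (1 / x ^ 2)) -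
        1 / 2 * (Real.cos (2 * x - 2 * x) * (1 / x ^ 3))) = 1 / (2 * x ^ 3) := by
    simp
    ring
  rw [h0] at hint
  linarith

lemma hasDerivAt_integral_Ioi {f : ℝ → ℝ} (hc : ContinuousOn f (Ioi 0))
    (hi : ∀ x > 0, IntegrableOn f (Ioi x)) {x : ℝ} (hx : 0 < x) :
    HasDerivAt (fun y => ∫ t in Ioi y, f t) (-f x) x := by
  have hx2 : 0 < x / 2 := by positivity
  have hFTC : HasDerivAt (fun y => ∫ t in (x / 2)..y, f t) (f x) x := by
    refine intervalIntegral.integral_hasDerivAt_right ?_ ?_ (hc.continuousAt (Ioi_mem_nhds hx))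
    · rw [intervalIntegrable_iff_integrableOn_Ioc_of_le (by linarith)]
      exact (hi _ hx2).mono_set Ioc_subset_Ioi_self
    · exact hc.stronglyMeasurableAtFilter isOpen_Ioi x hx
  refine (hFTC.const_sub (∫ t in Ioi (x / 2), f t)).congr_of_eventuallyEq ?_
  filter_upwards [Ioi_mem_nhds (by linarith : x / 2 < x)] with y hy
  have hy' : x / 2 < y := hy
  rw [intervalIntegral.integral_of_le hy'.le, ← Ioc_union_Ioi_eq_Ioi hy'.le,
    setIntegral_union Ioc_disjoint_Ioi_same measurableSet_Ioi
      ((hi _ hx2).mono_set Ioc_subset_Ioi_self) (hi _ (hx2.trans hy'))]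
  ring

lemma tendsto_integral_Ioi_atTop {f : ℝ → ℝ} (hf : ∀ t > 0, |f t| ≤ 1 * (1 / t ^ 2)) :
    Tendsto (fun y => ∫ t in Ioi y, f t) atTop (𝓝 0) := by
  have h0 : Tendsto (fun y : ℝ => 1 / y) atTop (𝓝 0) := by
    simpa using tendsto_one_div_pow_atTop one_ne_zero
  refine squeeze_zero_norm' ?_ h0
  filter_upwards [eventually_gt_atTop 0] with y hy
  rw [← integral_one_div_sq hy]
  refine norm_integral_le_of_norm_le (integrableOn_one_div_pow le_rfl hy) ?_
  refine (ae_restrict_iff' measurableSet_Ioi).mpr (Eventually.of_forall fun t ht => ?_)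
  simpa using hf t (hy.trans ht)

/-- The modulus of `∫ₓ^∞ exp(2 i t) / t² dt` is at most `1 / (2 x²)`. The derivative of the squared
modulus is `-2 / x²` times the cosine transform, which is at most `1 / (2 x³)`. -/
lemma sq_integral_sin_add_sq_integral_cos_le {x : ℝ} (hx : 0 < x) :
    (∫ t in Ioi x, Real.sin (2 * t - 0) / t ^ 2) ^ 2 +
      (∫ t in Ioi x, Real.cos (2 * t - 0) / t ^ 2) ^ 2 ≤ (1 / (2 * x ^ 2)) ^ 2 := by
  set P : ℝ → ℝ := fun y => ∫ t in Ioi y, Real.sin (2 * t - 0) / t ^ 2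
  set Q : ℝ → ℝ := fun y => ∫ t in Ioi y, Real.cos (2 * t - 0) / t ^ 2
  have hP : ∀ y > 0, HasDerivAt P (-(Real.sin (2 * y - 0) / y ^ 2)) y := fun y hy =>
    hasDerivAt_integral_Ioi (f := fun t => Real.sin (2 * t - 0) / t ^ 2)
      (ContinuousOn.div (by fun_prop) (by fun_prop) fun t ht => pow_ne_zero 2 (ne_of_gt ht))
      (fun z hz => integrableOn_sin_div_pow le_rfl hz 0) hy
  have hQ : ∀ y > 0, HasDerivAt Q (-(Real.cos (2 * y - 0) / y ^ 2)) y := fun y hy =>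
    hasDerivAt_integral_Ioi (f := fun t => Real.cos (2 * t - 0) / t ^ 2)
      (ContinuousOn.div (by fun_prop) (by fun_prop) fun t ht => pow_ne_zero 2 (ne_of_gt ht))
      (fun z hz => integrableOn_cos_div_pow le_rfl hz 0) hy
  have hd : ∀ y > 0, HasDerivAt (fun y => P y ^ 2 + Q y ^ 2 - 1 / 4 * (1 / y ^ 4))
      (-(2 * P y * (Real.sin (2 * y - 0) / y ^ 2)) - 2 * Q y * (Real.cos (2 * y - 0) / y ^ 2)
        + 1 / y ^ 5) y := by
    intro y hy
    have hy0 : y ≠ 0 := ne_of_gt hy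
    convert! (((hP y hy).pow 2).add ((hQ y hy).pow 2)).sub
      ((hasDerivAt_inv_pow 4 hy0).const_mul (1 / 4 : ℝ)) using 1
    push_cast
    field_simp
    ring
  have hcomb : ∀ y > 0, Real.cos (2 * y) * Q y + Real.sin (2 * y) * P y ≤ 1 / (2 * y ^ 3) := by
    intro y hy
    refine le_trans (le_of_eq ?_) (integral_cos_div_sq_le hy)
    simp only [P, Q]
    rw [← integral_const_mul, ← integral_const_mul, ← integral_add
      ((integrableOn_cos_div_pow le_rfl hy 0).const_mul _)
      ((integrableOn_sin_div_pow le_rfl hy 0).const_mul _)]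
    congr 1
    funext t
    rw [sub_zero, Real.cos_sub]
    ring
  have hlim : Tendsto (fun y => P y ^ 2 + Q y ^ 2 - 1 / 4 * (1 / y ^ 4)) atTop (𝓝 0) := by
    have l1 : Tendsto P atTop (𝓝 0) :=
      tendsto_integral_Ioi_atTop fun t ht => abs_sin_mul_div_pow_le 2 ht
    have l2 : Tendsto Q atTop (𝓝 0) :=
      tendsto_integral_Ioi_atTop fun t ht => abs_cos_mul_div_pow_le 2 ht
    simpa using ((l1.pow 2).add (l2.pow 2)).sub
      ((tendsto_one_div_pow_atTop four_ne_zero).const_mul (1 / 4 : ℝ))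
  have := le_of_hasDerivAt_nonneg_of_tendsto hd (fun y hy => ?_) hlim hx
  · have e : (1 / (2 * x ^ 2)) ^ 2 = 1 / 4 * (1 / x ^ 4) := by
      field_simp
      norm_num
    rw [e]
    linarith
  · have hy' : (0 : ℝ) < y := hy
    have e : -(2 * P y * (Real.sin (2 * y - 0) / y ^ 2)) -
        2 * Q y * (Real.cos (2 * y - 0) / y ^ 2) + 1 / y ^ 5 =
        2 / y ^ 2 * (1 / (2 * y ^ 3) - (Real.cos (2 * y) * Q y + Real.sin (2 * y) * P y)) := by
      rw [sub_zero]
      field_simp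
      ring
    rw [e]
    have := hcomb y hy
    have : 0 ≤ 1 / (2 * y ^ 3) - (Real.cos (2 * y) * Q y + Real.sin (2 * y) * P y) := by linarith
    positivity

lemma abs_integral_sin_div_sq_le {x : ℝ} (hx : 0 < x) (b : ℝ) :
    |∫ t in Ioi x, Real.sin (2 * t - b) / t ^ 2| ≤ 1 / (2 * x ^ 2) := by
  set P : ℝ := ∫ t in Ioi x, Real.sin (2 * t - 0) / t ^ 2 with hP
  set Q : ℝ := ∫ t in Ioi x, Real.cos (2 * t - 0) / t ^ 2 with hQ
  have h := sq_integral_sin_add_sq_integral_cos_le hx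
  rw [← hP, ← hQ] at h
  have e : ∫ t in Ioi x, Real.sin (2 * t - b) / t ^ 2 = Real.cos b * P - Real.sin b * Q := by
    rw [hP, hQ, ← integral_const_mul, ← integral_const_mul, ← integral_sub
      ((integrableOn_sin_div_pow le_rfl hx 0).const_mul _)
      ((integrableOn_cos_div_pow le_rfl hx 0).const_mul _)]
    congr 1
    funext t
    rw [sub_zero, Real.sin_sub]
    ring
  rw [e]
  refine abs_le_of_sq_le_sq (le_trans ?_ h) (by positivity)
  nlinarith [sq_nonneg (Real.cos b * Q + Real.sin b * P), Real.sin_sq_add_cos_sq b]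

/-! ### The mean-square bound and the iteration of Volterra's equation -/

namespace SolvesBesselNormalForm

variable {a c ω : ℝ} {u v : ℝ → ℝ}

lemma tendsto_sq_add_sq
    (hu : Tendsto (fun x => u x - c * Real.cos (x - ω)) atTop (𝓝 0))
    (hv : Tendsto (fun x => v x + c * Real.sin (x - ω)) atTop (𝓝 0)) :
    Tendsto (fun x => u x ^ 2 + v x ^ 2) atTop (𝓝 (c ^ 2)) := by
  have bcos : IsBoundedUnder (· ≤ ·) atTop ((‖·‖) ∘ fun x => Real.cos (x - ω)) :=
    isBoundedUnder_of ⟨1, fun x => Real.abs_cos_le_one _⟩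
  have bsin : IsBoundedUnder (· ≤ ·) atTop ((‖·‖) ∘ fun x => Real.sin (x - ω)) :=
    isBoundedUnder_of ⟨1, fun x => Real.abs_sin_le_one _⟩
  have l := ((((hu.zero_mul_isBoundedUnder_le bcos).sub
    (hv.zero_mul_isBoundedUnder_le bsin)).const_mul (2 * c)).add
      ((hu.pow 2).add (hv.pow 2))).const_add (c ^ 2)
  convert! l using 2 with x
  · linear_combination c ^ 2 * Real.sin_sq_add_cos_sq (x - ω)
  · simp

lemma tendsto_div_sq_mul {M : ℝ} {w : ℝ → ℝ} (hw : ∀ t ≥ 1, |w t| ≤ M) (b : ℝ) :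
    Tendsto (fun t => b / t ^ 2 * w t) atTop (𝓝 0) := by
  have hb : IsBoundedUnder (· ≤ ·) atTop ((‖·‖) ∘ w) :=
    isBoundedUnder_of_eventually_le (a := M) ((eventually_ge_atTop 1).mono hw)
  have := ((tendsto_one_div_pow_atTop two_ne_zero).const_mul b)
  rw [mul_zero] at this
  refine (this.zero_mul_isBoundedUnder_le hb).congr fun t => ?_
  ring

lemma hasDerivAt_one_sub_div_sq (a : ℝ) {x : ℝ} (hx : 0 < x) :
    HasDerivAt (fun x : ℝ => 1 - a / x ^ 2) (2 * a / x ^ 3) x := by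
  convert! (((hasDerivAt_inv_pow 2 hx.ne').const_mul a).const_sub 1) using 1
  · funext t
    ring
  · push_cast
    ring

/-- The energy `(1 - a / x²) u² + u'²` has derivative `2 a u² / x³`. -/
lemma hasDerivAt_energy (h : SolvesBesselNormalForm a u v) {x : ℝ} (hx : 0 < x) :
    HasDerivAt (fun x => (1 - a / x ^ 2) * u x ^ 2 + v x ^ 2) (2 * a * u x ^ 2 / x ^ 3) x := by
  have h1 := hasDerivAt_one_sub_div_sq a hx
  have hx0 := hx.ne'
  convert! (h1.mul ((h.hasDerivAt x hx).pow 2)).add ((h.hasDerivAt_deriv x hx).pow 2) using 1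
  simp only [Pi.pow_apply]
  push_cast
  field_simp
  ring

/-- Sonin's function `u² + u'² / (1 - a / x²)` has derivative `-2 a u'² / (x³ (1 - a / x²)²)`. -/
lemma hasDerivAt_sonin (h : SolvesBesselNormalForm a u v) {x : ℝ} (hx : 0 < x)
    (hq : 0 < 1 - a / x ^ 2) :
    HasDerivAt (fun x => u x ^ 2 + v x ^ 2 / (1 - a / x ^ 2))
      (-a * (2 * (v x / (1 - a / x ^ 2)) ^ 2 / x ^ 3)) x := by
  have h1 := hasDerivAt_one_sub_div_sq a hx
  have e : (a / x ^ 2 - 1) = -(1 - a / x ^ 2) := by ring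
  have hv := h.hasDerivAt_deriv x hx
  rw [e] at hv
  convert! ((h.hasDerivAt x hx).pow 2).add ((hv.pow 2).div h1 hq.ne') using 1
  simp only [Pi.pow_apply]
  generalize 1 - a / x ^ 2 = q at hq ⊢
  have hx0 := hx.ne'
  have hq0 := hq.ne'
  push_cast
  field_simp
  ring

lemma tendsto_one_sub_div_sq (a : ℝ) :
    Tendsto (fun x : ℝ => 1 - a / x ^ 2) atTop (𝓝 1) := by
  have := ((tendsto_one_div_pow_atTop two_ne_zero).const_mul a).const_sub 1
  simpa [div_eq_mul_inv] using this

lemma tendsto_sonin (h : SolvesBesselNormalForm a u v)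
    (hu : Tendsto (fun x => u x - c * Real.cos (x - ω)) atTop (𝓝 0))
    (hv : Tendsto (fun x => v x + c * Real.sin (x - ω)) atTop (𝓝 0)) :
    Tendsto (fun x => u x ^ 2 + v x ^ 2 / (1 - a / x ^ 2)) atTop (𝓝 (c ^ 2)) := by
  obtain ⟨M, hM0, hM⟩ := h.exists_abs_le
  have l0 := tendsto_one_sub_div_sq a
  have l1 : Tendsto (fun x => a / x ^ 2 * v x ^ 2) atTop (𝓝 0) :=
    tendsto_div_sq_mul (M := M ^ 2) (fun t ht => by
      rw [abs_pow]
      have := (hM t ht).2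
      gcongr) a
  have l2 := (tendsto_sq_add_sq hu hv).add (l1.div l0 one_ne_zero)
  rw [zero_div, add_zero] at l2
  refine l2.congr' ?_
  filter_upwards [l0.eventually_ne one_ne_zero] with x hx
  simp only [Pi.div_apply]
  field_simp
  ring

lemma tendsto_energy (h : SolvesBesselNormalForm a u v)
    (hu : Tendsto (fun x => u x - c * Real.cos (x - ω)) atTop (𝓝 0))
    (hv : Tendsto (fun x => v x + c * Real.sin (x - ω)) atTop (𝓝 0)) :
    Tendsto (fun x => (1 - a / x ^ 2) * u x ^ 2 + v x ^ 2) atTop (𝓝 (c ^ 2)) := by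
  obtain ⟨M, hM0, hM⟩ := h.exists_abs_le
  have l1 : Tendsto (fun x => a / x ^ 2 * u x ^ 2) atTop (𝓝 0) :=
    tendsto_div_sq_mul (M := M ^ 2) (fun t ht => by
      rw [abs_pow]
      have := (hM t ht).1
      gcongr) a
  have l2 := (tendsto_sq_add_sq hu hv).sub l1
  rw [sub_zero] at l2
  refine l2.congr fun x => ?_
  ring

/-- For `a ≤ 0` Sonin's function increases to `c²`, so the amplitude at infinity bounds `u`. -/
lemma sq_le_of_nonpos (h : SolvesBesselNormalForm a u v)
    (hu : Tendsto (fun x => u x - c * Real.cos (x - ω)) atTop (𝓝 0))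
    (hv : Tendsto (fun x => v x + c * Real.sin (x - ω)) atTop (𝓝 0)) (ha : a ≤ 0) {x : ℝ}
    (hx : 0 < x) : u x ^ 2 ≤ c ^ 2 := by
  have hq : ∀ y : ℝ, 0 < y → 0 < 1 - a / y ^ 2 := fun y hy => by
    have : a / y ^ 2 ≤ 0 := div_nonpos_of_nonpos_of_nonneg ha (by positivity)
    linarith
  have h1 := le_of_hasDerivAt_nonneg_of_tendsto (fun y hy => h.hasDerivAt_sonin hy (hq y hy))
    (fun y hy => by
      have hy' : (0 : ℝ) < y := hy
      have : 0 ≤ -a := by linarith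
      positivity) (h.tendsto_sonin hu hv) hx
  have h2 := hq x hx
  have : 0 ≤ v x ^ 2 / (1 - a / x ^ 2) := by positivity
  linarith

/-- For `a > 0` the energy is at least `c² (1 - a / x²)`: beyond the turning point `x = √a` because
Sonin's function decreases to `c²`, before it because the energy increases from `0`. -/
lemma le_energy_of_pos (h : SolvesBesselNormalForm a u v)
    (hu : Tendsto (fun x => u x - c * Real.cos (x - ω)) atTop (𝓝 0))
    (hv : Tendsto (fun x => v x + c * Real.sin (x - ω)) atTop (𝓝 0)) (ha : 0 < a)
    (h0 : Tendsto (fun x => (1 - a / x ^ 2) * u x ^ 2 + v x ^ 2) (𝓝[>] 0) (𝓝 0)) {x : ℝ}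
    (hx : 0 < x) : c ^ 2 * (1 - a / x ^ 2) ≤ (1 - a / x ^ 2) * u x ^ 2 + v x ^ 2 := by
  by_cases hxa : 1 - a / x ^ 2 ≤ 0
  · have h1 := le_of_hasDerivAt_nonneg_of_tendsto_nhdsGT (fun y hy => h.hasDerivAt_energy hy)
      (fun y hy => by
        have hy' : (0 : ℝ) < y := hy
        positivity) h0 hx
    nlinarith [sq_nonneg c]
  · rw [not_le] at hxa
    have hq : ∀ y : ℝ, √a < y → 0 < 1 - a / y ^ 2 := fun y hy => by
      have hy0 : 0 < y := (Real.sqrt_nonneg a).trans_lt hy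
      rw [sub_pos, div_lt_one (by positivity)]
      exact (Real.sqrt_lt' hy0).mp hy
    have hxa' : √a < x := by
      rw [Real.sqrt_lt' hx]
      rwa [sub_pos, div_lt_one (by positivity)] at hxa
    have h1 := le_of_hasDerivAt_nonneg_of_tendsto
      (fun y hy => (h.hasDerivAt_sonin ((Real.sqrt_nonneg a).trans_lt hy) (hq y hy)).neg)
      (fun y hy => by
        have hy' : (0 : ℝ) < y := (Real.sqrt_nonneg a).trans_lt hy
        rw [neg_mul, neg_neg]
        positivity) (h.tendsto_sonin hu hv).neg hxa'
    have h2 : c ^ 2 ≤ u x ^ 2 + v x ^ 2 / (1 - a / x ^ 2) := neg_le_neg_iff.mp h1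
    calc c ^ 2 * (1 - a / x ^ 2)
        ≤ (u x ^ 2 + v x ^ 2 / (1 - a / x ^ 2)) * (1 - a / x ^ 2) := by gcongr
      _ = _ := by rw [add_mul, div_mul_cancel₀ _ hxa.ne', mul_comm]

lemma integrableOn_sq_div_sq (h : SolvesBesselNormalForm a u v) {x : ℝ} (hx : 0 < x) :
    IntegrableOn (fun t => u t ^ 2 / t ^ 2) (Ioi x) := by
  obtain ⟨M, hM0, hM⟩ := h.exists_abs_le_of_pos hx
  refine integrableOn_Ioi_of_abs_le_div_pow (C := M ^ 2) le_rfl hx (continuousOn_div_pow 2 hx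
    ((h.continuousOn.mono (Ioi_subset_Ioi hx.le)).pow 2)) fun t ht => ?_
  have := (hM t (le_of_lt ht)).1
  rw [abs_div, abs_pow, abs_of_nonneg (sq_nonneg t), div_eq_mul_one_div]
  gcongr

/-- The mean-square bound that replaces `|u| ≤ c`, which fails for `a > 0`. There the excess
`D = u'² + (1 - a / t²) (u² - c²)` is nonnegative and `(t D)' = D + 2 a (u² - c²) / t²`, so that
`∫ₓ^∞ (u² - c²) / t² ≤ 0`. -/
lemma integral_sq_div_sq_le (h : SolvesBesselNormalForm a u v)
    (hu : Tendsto (fun x => u x - c * Real.cos (x - ω)) atTop (𝓝 0))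
    (hv : Tendsto (fun x => v x + c * Real.sin (x - ω)) atTop (𝓝 0))
    (h0 : 0 < a → Tendsto (fun x => (1 - a / x ^ 2) * u x ^ 2 + v x ^ 2) (𝓝[>] 0) (𝓝 0)) {x : ℝ}
    (hx : 0 < x) : ∫ t in Ioi x, u t ^ 2 / t ^ 2 ≤ c ^ 2 * (1 / x) := by
  have hI := h.integrableOn_sq_div_sq hx
  have hI2 : IntegrableOn (fun t : ℝ => c ^ 2 * (1 / t ^ 2)) (Ioi x) :=
    (integrableOn_one_div_pow le_rfl hx).const_mul _
  rw [← integral_one_div_sq hx, ← integral_const_mul]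
  rcases le_or_gt a 0 with ha | ha
  · refine setIntegral_mono_on hI hI2 measurableSet_Ioi fun t ht => ?_
    have := h.sq_le_of_nonpos hu hv ha (hx.trans ht)
    rw [← div_eq_mul_one_div]
    gcongr
  · set D : ℝ → ℝ := fun t => (1 - a / t ^ 2) * u t ^ 2 + v t ^ 2 - c ^ 2 * (1 - a / t ^ 2)
    have hD0 : ∀ t > 0, 0 ≤ D t := fun t ht => sub_nonneg.mpr (h.le_energy_of_pos hu hv ha (h0 ha) ht)
    have hD1 : ∀ t > 0, D t ≤ c ^ 2 * a * (1 / t ^ 2) := fun t ht => by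
      have := le_of_hasDerivAt_nonneg_of_tendsto (fun y hy => h.hasDerivAt_energy hy)
        (fun y hy => by
          have hy' : (0 : ℝ) < y := hy
          positivity) (h.tendsto_energy hu hv) ht
      calc D t ≤ c ^ 2 - c ^ 2 * (1 - a / t ^ 2) := sub_le_sub_right this _
        _ = _ := by ring
    have hDd : ∀ t > 0, HasDerivAt D (2 * a * u t ^ 2 / t ^ 3 - c ^ 2 * (2 * a / t ^ 3)) t := by
      intro t ht
      exact (h.hasDerivAt_energy ht).sub ((hasDerivAt_one_sub_div_sq a ht).const_mul (c ^ 2))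
    have hID : IntegrableOn D (Ioi x) := by
      refine integrableOn_Ioi_of_abs_le_div_pow (C := c ^ 2 * a) le_rfl hx
        (fun t ht => (hDd t (hx.trans ht)).continuousAt.continuousWithinAt) fun t ht => ?_
      rw [abs_of_nonneg (hD0 t (hx.trans ht))]
      exact hD1 t (hx.trans ht)
    have hd : ∀ t ∈ Ici x, HasDerivAt (fun t => t * D t)
        (D t + 2 * a * (u t ^ 2 / t ^ 2 - c ^ 2 * (1 / t ^ 2))) t := by
      intro t ht
      have ht0 : 0 < t := hx.trans_le ht
      convert! (hasDerivAt_id t).mul (hDd t ht0) using 1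
      simp only [id]
      field_simp
    have hlim : Tendsto (fun t => t * D t) atTop (𝓝 0) := by
      have l := (tendsto_one_div_pow_atTop one_ne_zero).const_mul (c ^ 2 * a)
      rw [mul_zero] at l
      refine squeeze_zero' ?_ ?_ l
      · filter_upwards [eventually_gt_atTop 0] with t ht
        exact mul_nonneg ht.le (hD0 t ht)
      · filter_upwards [eventually_gt_atTop 0] with t ht
        calc t * D t ≤ t * (c ^ 2 * a * (1 / t ^ 2)) := by
              have := hD1 t ht
              gcongr
          _ = _ := by field_simp
    have hIE : IntegrableOn (fun t => 2 * a * (u t ^ 2 / t ^ 2 - c ^ 2 * (1 / t ^ 2))) (Ioi x) :=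
      (hI.sub hI2).const_mul (2 * a)
    have hint := integral_Ioi_of_hasDerivAt_of_tendsto' hd (hID.add hIE) hlim
    rw [integral_add hID hIE, integral_const_mul,
      integral_sub hI hI2] at hint
    have hDi : 0 ≤ ∫ t in Ioi x, D t :=
      setIntegral_nonneg measurableSet_Ioi fun t ht => hD0 t (hx.trans ht)
    have hDx : 0 ≤ x * D x := mul_nonneg hx.le (hD0 x hx)
    have hneg : 2 * a * ((∫ t in Ioi x, u t ^ 2 / t ^ 2) - ∫ t in Ioi x, c ^ 2 * (1 / t ^ 2)) ≤ 0 := by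
      linarith
    have := nonpos_of_mul_nonpos_right hneg (by positivity)
    linarith

lemma integrableOn_sin_mul_div_sq {w : ℝ → ℝ} {x M : ℝ} (hx : 0 < x)
    (hw : ContinuousOn w (Ioi x)) (hM : ∀ t > x, |w t| ≤ M) :
    IntegrableOn (fun t => Real.sin (t - x) * w t / t ^ 2) (Ioi x) := by
  refine integrableOn_Ioi_of_abs_le_div_pow (C := M) le_rfl hx
    (continuousOn_div_pow 2 hx (ContinuousOn.mul (by fun_prop) hw)) fun t ht => ?_
  have h1 := hM t ht
  have h0 : 0 ≤ M := (abs_nonneg _).trans h1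
  have ht0 : 0 < t := hx.trans ht
  rw [abs_div, abs_mul, abs_of_nonneg (sq_nonneg t), div_eq_mul_one_div]
  have h2 := Real.abs_sin_le_one (t - x)
  have : |Real.sin (t - x)| * |w t| ≤ 1 * M := by gcongr
  rw [one_mul] at this
  gcongr

/-- Volterra's equation at infinity: variation of constants with the asymptotic cosine as the
unperturbed solution. -/
lemma sub_cos_eq_integral (h : SolvesBesselNormalForm a u v)
    (hu : Tendsto (fun x => u x - c * Real.cos (x - ω)) atTop (𝓝 0))
    (hv : Tendsto (fun x => v x + c * Real.sin (x - ω)) atTop (𝓝 0)) {x : ℝ} (hx : 0 < x) :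
    u x - c * Real.cos (x - ω) = a * ∫ t in Ioi x, Real.sin (t - x) * u t / t ^ 2 := by
  obtain ⟨M, hM0, hM⟩ := h.exists_abs_le_of_pos hx
  have hI := (integrableOn_sin_mul_div_sq hx (h.continuousOn.mono (Ioi_subset_Ioi hx.le))
    fun t ht => (hM t (le_of_lt ht)).1).const_mul a
  have hd : ∀ t ∈ Ici x, HasDerivAt
      (fun t => (v t + c * Real.sin (t - ω)) * Real.sin (t - x) -
        (u t - c * Real.cos (t - ω)) * Real.cos (t - x))
      (a * (Real.sin (t - x) * u t / t ^ 2)) t := by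
    intro t ht
    have ht0 : 0 < t := hx.trans_le ht
    have hs := fun b : ℝ => ((hasDerivAt_id t).sub_const b).sin
    have hc := fun b : ℝ => ((hasDerivAt_id t).sub_const b).cos
    convert! ((((h.hasDerivAt_deriv t ht0).add ((hs ω).const_mul c)).mul (hs x)).sub
      (((h.hasDerivAt t ht0).sub ((hc ω).const_mul c)).mul (hc x))) using 1
    simp only [id, Pi.add_apply, Pi.sub_apply]
    ring
  have hlim : Tendsto (fun t => (v t + c * Real.sin (t - ω)) * Real.sin (t - x) -
        (u t - c * Real.cos (t - ω)) * Real.cos (t - x)) atTop (𝓝 0) := by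
    have bcos : IsBoundedUnder (· ≤ ·) atTop ((‖·‖) ∘ fun t => Real.cos (t - x)) :=
      isBoundedUnder_of ⟨1, fun t => Real.abs_cos_le_one _⟩
    have bsin : IsBoundedUnder (· ≤ ·) atTop ((‖·‖) ∘ fun t => Real.sin (t - x)) :=
      isBoundedUnder_of ⟨1, fun t => Real.abs_sin_le_one _⟩
    simpa using (hv.zero_mul_isBoundedUnder_le bsin).sub (hu.zero_mul_isBoundedUnder_le bcos)
  have := integral_Ioi_of_hasDerivAt_of_tendsto' hd hI hlim
  rw [integral_const_mul] at this
  rw [this]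
  simp

/-- Error bound for the one-term approximation. By the arithmetic-geometric mean inequality
`|sin (t - x)| |u|` is at most `(3 c / 4) sin² (t - x) + u² / (3 c)`, and both terms integrate
against `1 / t²` with known bounds. -/
lemma abs_sub_cos_le (h : SolvesBesselNormalForm a u v) (hc : 0 < c)
    (hu : Tendsto (fun x => u x - c * Real.cos (x - ω)) atTop (𝓝 0))
    (hv : Tendsto (fun x => v x + c * Real.sin (x - ω)) atTop (𝓝 0))
    (h0 : 0 < a → Tendsto (fun x => (1 - a / x ^ 2) * u x ^ 2 + v x ^ 2) (𝓝[>] 0) (𝓝 0)) {x : ℝ}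
    (hx : 0 < x) : |u x - c * Real.cos (x - ω)| ≤ 17 / 24 * (|a| * c) * (1 / x) := by
  have hIs := (integrableOn_sin_sq_div_pow le_rfl hx).const_mul (3 * c / 4)
  have hIu := (h.integrableOn_sq_div_sq hx).const_mul (1 / (3 * c))
  have key : |∫ t in Ioi x, Real.sin (t - x) * u t / t ^ 2| ≤ 17 / 24 * c * (1 / x) := by
    calc |∫ t in Ioi x, Real.sin (t - x) * u t / t ^ 2|
        ≤ ∫ t in Ioi x, (3 * c / 4 * (Real.sin (t - x) ^ 2 / t ^ 2) +
            1 / (3 * c) * (u t ^ 2 / t ^ 2)) := by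
          rw [← Real.norm_eq_abs]
          refine norm_integral_le_of_norm_le (hIs.add hIu) ?_
          refine (ae_restrict_iff' measurableSet_Ioi).mpr (Eventually.of_forall fun t ht => ?_)
          have ht0 : 0 < t := hx.trans ht
          have e : 3 * c / 4 * (Real.sin (t - x) ^ 2 / t ^ 2) + 1 / (3 * c) * (u t ^ 2 / t ^ 2) =
              (3 * c / 4 * Real.sin (t - x) ^ 2 + 1 / (3 * c) * u t ^ 2) / t ^ 2 := by ring
          rw [Real.norm_eq_abs, abs_div, abs_of_nonneg (sq_nonneg t), e]
          gcongr
          have e2 : 3 * c / 4 * Real.sin (t - x) ^ 2 + 1 / (3 * c) * u t ^ 2 =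
              (3 * c * |Real.sin (t - x)| - 2 * |u t|) ^ 2 / (12 * c) +
                |Real.sin (t - x) * u t| := by
            rw [abs_mul, ← sq_abs (Real.sin _), ← sq_abs (u t)]
            field_simp
            ring
          rw [e2]
          have : 0 ≤ (3 * c * |Real.sin (t - x)| - 2 * |u t|) ^ 2 / (12 * c) := by positivity
          linarith
      _ = 3 * c / 4 * (∫ t in Ioi x, Real.sin (t - x) ^ 2 / t ^ 2) +
            1 / (3 * c) * ∫ t in Ioi x, u t ^ 2 / t ^ 2 := by
          rw [integral_add hIs hIu, integral_const_mul, integral_const_mul]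
      _ ≤ 3 * c / 4 * (1 / 2 * (1 / x)) + 1 / (3 * c) * (c ^ 2 * (1 / x)) := by
          have h1 := integral_sin_sq_div_pow_le le_rfl hx
          rw [integral_one_div_sq hx] at h1
          have h2 := h.integral_sq_div_sq_le hu hv h0 hx
          gcongr
      _ = _ := by
          field_simp
          norm_num
  rw [h.sub_cos_eq_integral hu hv hx, abs_mul]
  calc |a| * _ ≤ |a| * (17 / 24 * c * (1 / x)) := by gcongr
    _ = _ := by ring

lemma integrableOn_abs_sin_div_cube {x : ℝ} (hx : 0 < x) :
    IntegrableOn (fun t => |Real.sin (t - x)| / t ^ 3) (Ioi x) := by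
  refine integrableOn_Ioi_of_abs_le_div_pow (n := 3) (C := 1) (by norm_num) hx
    (continuousOn_div_pow 3 hx (by fun_prop)) fun t ht => ?_
  rw [abs_div, abs_abs, ← abs_div]
  exact abs_sin_mul_div_pow_le 3 (hx.trans ht)

/-- The first absolute moment of the kernel, by `|sin| ≤ (3 / 4) sin² + 1 / 3`. The multiplier
`3 / 2` of the arithmetic-geometric mean inequality is a rational substitute for the optimal `√2`. -/
lemma integral_abs_sin_div_cube_le {x : ℝ} (hx : 0 < x) :
    ∫ t in Ioi x, |Real.sin (t - x)| / t ^ 3 ≤ 17 / 48 * (1 / x ^ 2) := by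
  have hIs := (integrableOn_sin_sq_div_pow (n := 3) (by norm_num) hx).const_mul (3 / 4 : ℝ)
  have hI1 := (integrableOn_one_div_pow (n := 3) (by norm_num) hx).const_mul (1 / 3 : ℝ)
  have hI := integrableOn_abs_sin_div_cube hx
  calc ∫ t in Ioi x, |Real.sin (t - x)| / t ^ 3
      ≤ ∫ t in Ioi x, (3 / 4 * (Real.sin (t - x) ^ 2 / t ^ 3) + 1 / 3 * (1 / t ^ 3)) := by
        refine setIntegral_mono_on hI (hIs.add hI1) measurableSet_Ioi fun t ht => ?_
        have ht0 : 0 < t := hx.trans ht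
        have e : 3 / 4 * (Real.sin (t - x) ^ 2 / t ^ 3) + 1 / 3 * (1 / t ^ 3) =
            (3 / 4 * |Real.sin (t - x)| ^ 2 + 1 / 3) / t ^ 3 := by
          rw [sq_abs]
          ring
        rw [e]
        gcongr
        nlinarith [sq_nonneg (3 * |Real.sin (t - x)| - 2)]
    _ = 3 / 4 * (∫ t in Ioi x, Real.sin (t - x) ^ 2 / t ^ 3) + 1 / 3 * (1 / (2 * x ^ 2)) := by
        rw [integral_add hIs hI1, integral_const_mul, integral_const_mul, integral_one_div_cube hx]
    _ ≤ 3 / 4 * (1 / 2 * (1 / (2 * x ^ 2))) + 1 / 3 * (1 / (2 * x ^ 2)) := by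
        have h1 := integral_sin_sq_div_pow_le (n := 3) (by norm_num) hx
        rw [integral_one_div_cube hx] at h1
        gcongr
    _ = _ := by
        field_simp
        norm_num

lemma integral_sin_mul_cos_div_sq {x : ℝ} (hx : 0 < x) (ω : ℝ) :
    ∫ t in Ioi x, Real.sin (t - x) * Real.cos (t - ω) / t ^ 2 =
      1 / 2 * (∫ t in Ioi x, Real.sin (2 * t - (x + ω)) / t ^ 2) -
        Real.sin (x - ω) / (2 * x) := by
  have e : ∀ t : ℝ, Real.sin (t - x) * Real.cos (t - ω) / t ^ 2 =
      1 / 2 * (Real.sin (2 * t - (x + ω)) / t ^ 2) - Real.sin (x - ω) / 2 * (1 / t ^ 2) := by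
    intro t
    have h1 : 2 * t - (x + ω) = (t - x) + (t - ω) := by ring
    have h2 : x - ω = (t - ω) - (t - x) := by ring
    rw [h1, h2, Real.sin_add, Real.sin_sub (t - ω) (t - x)]
    ring
  simp_rw [e]
  rw [integral_sub ((integrableOn_sin_div_pow le_rfl hx _).const_mul _)
    ((integrableOn_one_div_pow le_rfl hx).const_mul _), integral_const_mul, integral_const_mul,
    integral_one_div_sq hx]
  ring

/-- Error bound for the two-term approximation, by one more iteration of Volterra's equation.
The coefficient `289 / 1152` is `17 / 24` from `abs_sub_cos_le` times `17 / 48` from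
`integral_abs_sin_div_cube_le`. -/
lemma abs_sub_two_term_le (h : SolvesBesselNormalForm a u v) (hc : 0 < c)
    (hu : Tendsto (fun x => u x - c * Real.cos (x - ω)) atTop (𝓝 0))
    (hv : Tendsto (fun x => v x + c * Real.sin (x - ω)) atTop (𝓝 0))
    (h0 : 0 < a → Tendsto (fun x => (1 - a / x ^ 2) * u x ^ 2 + v x ^ 2) (𝓝[>] 0) (𝓝 0)) {x : ℝ}
    (hx : 0 < x) :
    |u x - c * (Real.cos (x - ω) - a * (Real.sin (x - ω) / (2 * x)))| ≤
      (|a| * c / 4 + 289 / 1152 * (|a| ^ 2 * c)) * (1 / x ^ 2) := by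
  set r : ℝ → ℝ := fun t => u t - c * Real.cos (t - ω)
  have hrc : ContinuousOn r (Ioi x) :=
    (h.continuousOn.mono (Ioi_subset_Ioi hx.le)).sub (by fun_prop)
  set K : ℝ := 17 / 24 * (|a| * c)
  have hK : 0 ≤ K := by positivity
  have hr : ∀ t > 0, |r t| ≤ K * (1 / t) := fun t ht => h.abs_sub_cos_le hc hu hv h0 ht
  have hI1 : IntegrableOn (fun t => Real.sin (t - x) * Real.cos (t - ω) / t ^ 2) (Ioi x) :=
    integrableOn_sin_mul_div_sq hx (by fun_prop) fun t _ => Real.abs_cos_le_one _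
  have hI2 : IntegrableOn (fun t => Real.sin (t - x) * r t / t ^ 2) (Ioi x) :=
    integrableOn_sin_mul_div_sq hx hrc (M := K * (1 / x)) fun t ht => (hr t (hx.trans ht)).trans (by
      have : x ≤ t := le_of_lt ht
      gcongr)
  have hsplit : ∫ t in Ioi x, Real.sin (t - x) * u t / t ^ 2 =
      c * (∫ t in Ioi x, Real.sin (t - x) * Real.cos (t - ω) / t ^ 2) +
        ∫ t in Ioi x, Real.sin (t - x) * r t / t ^ 2 := by
    rw [← integral_const_mul, ← integral_add (hI1.const_mul c) hI2]
    congr 1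
    funext t
    simp only [r]
    ring
  have hrem : |∫ t in Ioi x, Real.sin (t - x) * r t / t ^ 2| ≤ K * (17 / 48 * (1 / x ^ 2)) := by
    have hI3 := integrableOn_abs_sin_div_cube hx
    calc |∫ t in Ioi x, Real.sin (t - x) * r t / t ^ 2|
        ≤ ∫ t in Ioi x, K * (|Real.sin (t - x)| / t ^ 3) := by
          rw [← Real.norm_eq_abs]
          refine norm_integral_le_of_norm_le (hI3.const_mul K) ?_
          refine (ae_restrict_iff' measurableSet_Ioi).mpr (Eventually.of_forall fun t ht => ?_)
          have ht0 : 0 < t := hx.trans ht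
          rw [Real.norm_eq_abs, abs_div, abs_mul, abs_of_nonneg (sq_nonneg t)]
          calc |Real.sin (t - x)| * |r t| / t ^ 2
              ≤ |Real.sin (t - x)| * (K * (1 / t)) / t ^ 2 := by
                have := hr t ht0
                gcongr
            _ = _ := by
                field_simp
      _ ≤ _ := by
          rw [integral_const_mul]
          have := integral_abs_sin_div_cube_le hx
          gcongr
  have hosc := abs_integral_sin_div_sq_le hx (x + ω)
  have e : u x - c * (Real.cos (x - ω) - a * (Real.sin (x - ω) / (2 * x))) =
      a * c / 2 * (∫ t in Ioi x, Real.sin (2 * t - (x + ω)) / t ^ 2) +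
        a * ∫ t in Ioi x, Real.sin (t - x) * r t / t ^ 2 := by
    have := h.sub_cos_eq_integral hu hv hx
    rw [hsplit, integral_sin_mul_cos_div_sq hx] at this
    linear_combination this
  rw [e]
  refine (abs_add_le _ _).trans ?_
  rw [abs_mul, abs_mul a, abs_div, abs_mul, abs_of_pos hc, abs_two]
  calc |a| * c / 2 * _ + |a| * _
      ≤ |a| * c / 2 * (1 / (2 * x ^ 2)) + |a| * (K * (17 / 48 * (1 / x ^ 2))) := by gcongr
    _ = _ := by
        simp only [K]
        ring

end SolvesBesselNormalForm

/-! ### The Liouville transform of the Bessel function -/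

/-- The Liouville transform `√x J_μ(x) = x ^ (μ + 1 / 2) g_μ(x)` of the Bessel function. -/
noncomputable def besselLiouville (μ x : ℝ) : ℝ := x ^ (μ + 1 / 2) * besselEven μ x

/-- The derivative of `besselLiouville` on `(0, ∞)`. -/
noncomputable def besselLiouvilleDeriv (μ x : ℝ) : ℝ :=
  (μ + 1 / 2) * x ^ (μ - 1 / 2) * besselEven μ x + x ^ (μ + 1 / 2) * besselEvenDeriv μ x

lemma sqrt_mul_besselJ {μ x : ℝ} (hx : 0 < x) : √x * besselJ μ x = besselLiouville μ x := by
  rw [besselJ_eq_rpow_mul hx, besselLiouville, Real.sqrt_eq_rpow, Real.rpow_add hx]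
  ring

lemma solvesBesselNormalForm_besselLiouville {μ : ℝ} (hμ : -(1 / 2 : ℝ) < μ) :
    SolvesBesselNormalForm (μ ^ 2 - 1 / 4) (besselLiouville μ) (besselLiouvilleDeriv μ) where
  hasDerivAt x hx := by
    convert! (Real.hasDerivAt_rpow_const (p := μ + 1 / 2) (Or.inl (ne_of_gt hx))).mul
      (hasDerivAt_besselEven hμ x) using 1
    rw [besselLiouvilleDeriv]
    ring_nf
  hasDerivAt_deriv x hx := by
    have hx0 : x ≠ 0 := ne_of_gt hx
    convert! (((Real.hasDerivAt_rpow_const (p := μ - 1 / 2) (Or.inl hx0)).const_mul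
      (μ + 1 / 2)).mul (hasDerivAt_besselEven hμ x)).add
      ((Real.hasDerivAt_rpow_const (p := μ + 1 / 2) (Or.inl hx0)).mul
      (hasDerivAt_besselEvenDeriv hμ hx0)) using 1
    have e1 : x ^ (μ + 1 / 2) = x ^ 2 * x ^ (μ - 1 / 2 - 1) := by
      rw [← Real.rpow_natCast x 2, ← Real.rpow_add hx]
      norm_num
      ring_nf
    have e2 : x ^ (μ - 1 / 2) = x * x ^ (μ - 1 / 2 - 1) := by
      rw [Real.rpow_sub_one hx0]
      field_simp
    rw [besselLiouville, show μ + 1 / 2 - 1 = μ - 1 / 2 by ring, e1, e2]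
    field_simp
    ring

lemma continuous_besselEven {μ : ℝ} (hμ : -(1 / 2 : ℝ) < μ) : Continuous (besselEven μ) :=
  continuous_iff_continuousAt.mpr fun x => (hasDerivAt_besselEven hμ x).continuousAt

lemma continuous_besselEvenDeriv {μ : ℝ} (hμ : -(1 / 2 : ℝ) < μ) :
    Continuous (besselEvenDeriv μ) := by
  have : Continuous (besselEntire (μ + 1)) := continuous_iff_continuousAt.mpr fun x =>
    (hasDerivAt_besselEntire (by linarith : -(1 / 2 : ℝ) < μ + 1) x).continuousAt
  unfold besselEvenDeriv
  fun_prop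

/-- On `[1, ∞)` the bounds for `u = x ^ (μ + 1 / 2) g_μ` and `u'` carry over to `g_μ` and `g_μ'`, because
`x ^ (μ + 1 / 2) ≥ 1` there. -/
lemma exists_abs_besselEven_le {μ : ℝ} (hμ : -(1 / 2 : ℝ) < μ) :
    ∃ C, 0 ≤ C ∧ ∀ x ≥ 0, |besselEven μ x| ≤ C ∧ |besselEvenDeriv μ x| ≤ C := by
  obtain ⟨M, hM0, hM⟩ := (solvesBesselNormalForm_besselLiouville hμ).exists_abs_le
  obtain ⟨C1, hC1⟩ := (isCompact_Icc (a := (0 : ℝ)) (b := 1)).exists_bound_of_continuousOn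
    (continuous_besselEven hμ).continuousOn
  obtain ⟨C2, hC2⟩ := (isCompact_Icc (a := (0 : ℝ)) (b := 1)).exists_bound_of_continuousOn
    (continuous_besselEvenDeriv hμ).continuousOn
  have hp : 0 < μ + 1 / 2 := by linarith
  refine ⟨max (M + (μ + 1 / 2) * M) (max C1 C2), le_max_of_le_left (by positivity), fun x hx => ?_⟩
  rcases le_total x 1 with h1 | h1
  · exact ⟨(hC1 x ⟨hx, h1⟩).trans (le_max_of_le_right (le_max_left _ _)),
      (hC2 x ⟨hx, h1⟩).trans (le_max_of_le_right (le_max_right _ _))⟩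
  · have hx0 : 0 < x := by linarith
    have hxp : 1 ≤ x ^ (μ + 1 / 2) := Real.one_le_rpow h1 hp.le
    have key : ∀ y, |y| ≤ |x ^ (μ + 1 / 2) * y| := fun y => by
      rw [abs_mul, abs_of_nonneg (by positivity : 0 ≤ x ^ (μ + 1 / 2))]
      exact le_mul_of_one_le_left (abs_nonneg y) hxp
    have hg : |besselEven μ x| ≤ M := (key _).trans (hM x h1).1
    refine ⟨le_max_of_le_left (hg.trans (by nlinarith)), le_max_of_le_left ((key _).trans ?_)⟩
    have e : x ^ (μ + 1 / 2) * besselEvenDeriv μ x =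
        besselLiouvilleDeriv μ x - (μ + 1 / 2) * (besselLiouville μ x / x) := by
      rw [besselLiouvilleDeriv, besselLiouville, show μ + 1 / 2 = μ - 1 / 2 + 1 by ring,
        Real.rpow_add_one hx0.ne']
      field_simp
      ring
    rw [e]
    refine (abs_sub _ _).trans (add_le_add (hM x h1).2 ?_)
    rw [abs_mul, abs_of_pos hp, abs_div, abs_of_pos hx0]
    gcongr
    exact (div_le_self (abs_nonneg _) h1).trans (hM x h1).1

lemma exists_abs_besselLiouville_le {μ : ℝ} (hμ : -(1 / 2 : ℝ) < μ) :
    ∃ C, ∀ x > 0, |besselLiouville μ x| ≤ C := by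
  obtain ⟨M, hM0, hM⟩ := (solvesBesselNormalForm_besselLiouville hμ).exists_abs_le
  obtain ⟨C, hC0, hC⟩ := exists_abs_besselEven_le hμ
  refine ⟨max M C, fun x hx => ?_⟩
  have hx' : 0 < x := hx
  rcases le_total 1 x with h1 | h1
  · exact (hM x h1).1.trans (le_max_left _ _)
  · refine le_max_of_le_right ?_
    rw [besselLiouville, abs_mul, abs_of_nonneg (by positivity)]
    calc x ^ (μ + 1 / 2) * |besselEven μ x| ≤ 1 * C := by
          gcongr
          · exact Real.rpow_le_one hx'.le h1 (by linarith)
          · exact (hC x hx'.le).1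
      _ = C := one_mul C

/-- For `μ > 1 / 2` the energy of `√x J_μ(x)` vanishes at the origin, since `u / x` and `u'` are of
order `x ^ (μ - 1 / 2)` there. -/
lemma tendsto_energy_besselLiouville_zero {μ : ℝ} (hμ : (1 / 2 : ℝ) < μ) :
    Tendsto (fun x => (1 - (μ ^ 2 - 1 / 4) / x ^ 2) * besselLiouville μ x ^ 2 +
      besselLiouvilleDeriv μ x ^ 2) (𝓝[>] 0) (𝓝 0) := by
  have hμ' : -(1 / 2 : ℝ) < μ := by linarith
  have hg : Tendsto (besselEven μ) (𝓝[>] 0) (𝓝 (besselEven μ 0)) :=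
    (continuous_besselEven hμ').continuousAt.continuousWithinAt
  have hg1 : Tendsto (besselEvenDeriv μ) (𝓝[>] 0) (𝓝 (besselEvenDeriv μ 0)) :=
    (continuous_besselEvenDeriv hμ').continuousAt.continuousWithinAt
  have hpow : ∀ q : ℝ, 0 < q → Tendsto (fun x : ℝ => x ^ q) (𝓝[>] 0) (𝓝 0) := fun q hq => by
    have := (Real.continuousAt_rpow_const 0 q (Or.inr hq.le)).tendsto
    rw [Real.zero_rpow hq.ne'] at this
    exact this.mono_left nhdsWithin_le_nhds
  have l0 := (hpow (μ + 1 / 2) (by linarith)).mul hg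
  have l1 := (hpow (μ - 1 / 2) (by linarith)).mul hg
  have l2 := (hpow (μ + 1 / 2) (by linarith)).mul hg1
  have l := ((l0.pow 2).sub ((l1.pow 2).const_mul (μ ^ 2 - 1 / 4))).add
    (((l1.const_mul (μ + 1 / 2)).add l2).pow 2)
  simp only [zero_mul, mul_zero, add_zero, sub_zero, ne_eq, OfNat.ofNat_ne_zero, not_false_eq_true,
    zero_pow] at l
  refine l.congr' ?_
  filter_upwards [self_mem_nhdsWithin] with x hx
  have hx0 : x ≠ 0 := ne_of_gt hx
  rw [besselLiouvilleDeriv, besselLiouville, show μ + 1 / 2 = μ - 1 / 2 + 1 by ring,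
    Real.rpow_add_one hx0]
  field_simp

/-! ### The Laplace transform and its differential equation -/

/-- The weight `x ^ (2 μ) g_μ(x) = x ^ μ J_μ(x)`, multiplied by `exp (-(ε + i) x)`. -/
noncomputable def laplaceIntegrand (μ ε x : ℝ) : ℂ :=
  Complex.exp (-((ε + Complex.I) * x)) * ((x ^ (2 * μ) * besselEven μ x : ℝ) : ℂ)

/-- The Laplace transform of `x ^ μ J_μ(x)` at `ε + i`. The point `i` is the singularity of the
transform that carries the large-argument behaviour of `J_μ`. -/
noncomputable def besselLaplace (μ ε : ℝ) : ℂ := ∫ x in Ioi (0 : ℝ), laplaceIntegrand μ ε x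

lemma norm_exp_neg_add_I_mul (ε x : ℝ) :
    ‖Complex.exp (-((ε + Complex.I) * x))‖ = Real.exp (-ε * x) := by
  rw [Complex.norm_exp]
  simp

lemma integrableOn_rpow_mul_exp {k ε : ℝ} (hk : -1 < k) (hε : 0 < ε) :
    IntegrableOn (fun x : ℝ => x ^ k * Real.exp (-ε * x)) (Ioi 0) := by
  simpa using integrableOn_rpow_mul_exp_neg_mul_rpow hk one_pos hε

lemma continuousOn_exp_mul_rpow_mul (ε k : ℝ) {w : ℝ → ℝ} (hw : ContinuousOn w (Ioi 0)) :
    ContinuousOn (fun x : ℝ => Complex.exp (-((ε + Complex.I) * x)) * ((x ^ k * w x : ℝ) : ℂ))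
      (Ioi 0) := by
  refine ContinuousOn.mul (by fun_prop) (Complex.continuous_ofReal.comp_continuousOn ?_)
  exact ContinuousOn.mul (fun x hx => (Real.continuousAt_rpow_const x k
    (Or.inl (ne_of_gt hx))).continuousWithinAt) hw

lemma norm_exp_mul_rpow_mul_le {ε k C y x : ℝ} (hx : 0 < x) (hy : |y| ≤ C) :
    ‖Complex.exp (-((ε + Complex.I) * x)) * ((x ^ k * y : ℝ) : ℂ)‖ ≤
      C * (x ^ k * Real.exp (-ε * x)) := by
  rw [norm_mul, norm_exp_neg_add_I_mul, Complex.norm_real, Real.norm_eq_abs, abs_mul,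
    abs_of_nonneg (by positivity : 0 ≤ x ^ k)]
  calc Real.exp (-ε * x) * (x ^ k * |y|) ≤ Real.exp (-ε * x) * (x ^ k * C) := by gcongr
    _ = _ := by ring

lemma integrableOn_exp_mul_rpow_mul {k ε C : ℝ} {w : ℝ → ℝ} (hk : -1 < k) (hε : 0 < ε)
    (hw : ContinuousOn w (Ioi 0)) (hC : ∀ x > 0, |w x| ≤ C) :
    IntegrableOn (fun x : ℝ => Complex.exp (-((ε + Complex.I) * x)) * ((x ^ k * w x : ℝ) : ℂ))
      (Ioi 0) := by
  refine ((integrableOn_rpow_mul_exp hk hε).const_mul C).mono'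
    ((continuousOn_exp_mul_rpow_mul ε k hw).aestronglyMeasurable measurableSet_Ioi) ?_
  exact (ae_restrict_iff' measurableSet_Ioi).mpr (Eventually.of_forall fun x hx =>
    norm_exp_mul_rpow_mul_le hx (hC x hx))

/-- The first moment `∫ exp (-(ε + i) x) x ^ (2 μ + 1) g_μ(x) dx`, the negative of the derivative of
the Laplace transform. -/
noncomputable def besselLaplaceMoment (μ ε : ℝ) : ℂ :=
  ∫ x in Ioi (0 : ℝ), Complex.exp (-((ε + Complex.I) * x)) *
    ((x ^ (2 * μ + 1) * besselEven μ x : ℝ) : ℂ)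

lemma hasDerivAt_besselLaplace {μ ε : ℝ} (hμ : -(1 / 2 : ℝ) < μ) (hε : 0 < ε) :
    HasDerivAt (besselLaplace μ) (-besselLaplaceMoment μ ε) ε := by
  obtain ⟨C, hC0, hC⟩ := exists_abs_besselEven_le hμ
  have hcont := (continuous_besselEven hμ).continuousOn (s := Ioi 0)
  have hbd : ∀ x > 0, |besselEven μ x| ≤ C := fun x hx => (hC x (le_of_lt hx)).1
  set F' : ℝ → ℝ → ℂ := fun ε x => -(Complex.exp (-((ε + Complex.I) * x)) *
    ((x ^ (2 * μ + 1) * besselEven μ x : ℝ) : ℂ))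
  have hmain := (hasDerivAt_integral_of_dominated_loc_of_deriv_le
    (μ := volume.restrict (Ioi (0 : ℝ))) (F := laplaceIntegrand μ) (F' := F') (x₀ := ε)
    (s := Ioi (ε / 2))
    (bound := fun x => C * (x ^ (2 * μ + 1) * Real.exp (-(ε / 2) * x)))
    (Ioi_mem_nhds (by linarith))
    (Eventually.of_forall fun δ => (continuousOn_exp_mul_rpow_mul δ (2 * μ)
      hcont).aestronglyMeasurable measurableSet_Ioi)
    (integrableOn_exp_mul_rpow_mul (by linarith) hε hcont hbd)
    ((continuousOn_exp_mul_rpow_mul ε (2 * μ + 1) hcont).neg.aestronglyMeasurable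
      measurableSet_Ioi)
    ?_ ((integrableOn_rpow_mul_exp (by linarith) (by positivity)).const_mul C) ?_).2
  · simp only [F'] at hmain
    rwa [integral_neg] at hmain
  · refine (ae_restrict_iff' measurableSet_Ioi).mpr (Eventually.of_forall fun x hx δ hδ => ?_)
    have hx0 : 0 < x := hx
    have hδ' : ε / 2 < δ := hδ
    rw [norm_neg]
    refine (norm_exp_mul_rpow_mul_le hx0 (hbd x hx0)).trans ?_
    gcongr
  · refine (ae_restrict_iff' measurableSet_Ioi).mpr (Eventually.of_forall fun x hx δ hδ => ?_)
    have hx0 : x ≠ 0 := ne_of_gt hx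
    have h1 : HasDerivAt (fun δ : ℝ => -(((δ : ℂ) + Complex.I) * x)) (-(1 * (x : ℂ))) δ :=
      (((Complex.ofRealCLM.hasDerivAt (x := δ)).add_const Complex.I).mul_const (x : ℂ)).neg
    convert! h1.cexp.mul_const ((x ^ (2 * μ) * besselEven μ x : ℝ) : ℂ) using 1
    simp only [F', Real.rpow_add_one hx0]
    push_cast
    ring

/-- The Bessel equation turns into a first order equation for the Laplace transform `F`, namely
`(1 + s²) F'(s) + (2 μ + 1) s F(s) = 0`, here at `s = ε + i`: the integrand of the left side is the
derivative of `exp (-s x) x ^ (2 μ + 1) (g'(x) + s g(x))`. -/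
lemma besselLaplace_equation {μ ε : ℝ} (hμ : -(1 / 2 : ℝ) < μ) (hε : 0 < ε) :
    (2 * μ + 1) * (ε + Complex.I) * besselLaplace μ ε -
      (1 + (ε + Complex.I) ^ 2) * besselLaplaceMoment μ ε = 0 := by
  obtain ⟨C, hC0, hC⟩ := exists_abs_besselEven_le hμ
  have hcont := (continuous_besselEven hμ).continuousOn (s := Ioi 0)
  have hbd : ∀ x > 0, |besselEven μ x| ≤ C := fun x hx => (hC x (le_of_lt hx)).1
  set s : ℂ := ε + Complex.I with hs
  have hp : 0 < 2 * μ + 1 := by linarith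
  set f : ℝ → ℂ := fun x => Complex.exp (-(s * x)) *
    (((x ^ (2 * μ + 1) : ℝ) : ℂ) * (besselEvenDeriv μ x + s * besselEven μ x))
  have hI1 : IntegrableOn (laplaceIntegrand μ ε) (Ioi 0) :=
    integrableOn_exp_mul_rpow_mul (by linarith) hε hcont hbd
  have hI2 : IntegrableOn (fun x : ℝ => Complex.exp (-((ε + Complex.I) * x)) *
      ((x ^ (2 * μ + 1) * besselEven μ x : ℝ) : ℂ)) (Ioi 0) :=
    integrableOn_exp_mul_rpow_mul (by linarith) hε hcont hbd
  have hf0 : ContinuousWithinAt f (Ici 0) 0 := by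
    have h1 := Real.continuousAt_rpow_const 0 (2 * μ + 1) (Or.inr hp.le)
    have h2 := continuous_besselEven hμ
    have h3 := continuous_besselEvenDeriv hμ
    have h4 : ContinuousAt (fun x : ℝ => ((x ^ (2 * μ + 1) : ℝ) : ℂ)) 0 :=
      Complex.continuous_ofReal.continuousAt.comp h1
    refine ContinuousAt.continuousWithinAt ?_
    exact ContinuousAt.mul (by fun_prop) (h4.mul (by fun_prop))
  have hd : ∀ x ∈ Ioi (0 : ℝ), HasDerivAt f ((2 * μ + 1) * s * laplaceIntegrand μ ε x -
      (1 + s ^ 2) * (Complex.exp (-((ε + Complex.I) * x)) *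
      ((x ^ (2 * μ + 1) * besselEven μ x : ℝ) : ℂ))) x := by
    intro x hx
    have hx0 : x ≠ 0 := ne_of_gt hx
    have h1 : HasDerivAt (fun x : ℝ => -(s * (x : ℂ))) (-(s * 1)) x :=
      ((Complex.ofRealCLM.hasDerivAt (x := x)).const_mul s).neg
    have h2 := (Real.hasDerivAt_rpow_const (p := 2 * μ + 1) (Or.inl hx0)).ofReal_comp
    have h3 := (hasDerivAt_besselEvenDeriv hμ hx0).ofReal_comp
    have h4 := (hasDerivAt_besselEven hμ x).ofReal_comp
    convert! h1.cexp.mul (h2.mul (h3.add (h4.const_mul s))) using 1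
    have hxc : (x : ℂ) ≠ 0 := by exact_mod_cast hx0
    simp only [laplaceIntegrand, ← hs, add_sub_cancel_right, Real.rpow_add_one hx0, Pi.add_apply,
      Pi.mul_apply]
    push_cast
    field_simp
    ring
  have hlim : Tendsto f atTop (𝓝 0) := by
    have l := (tendsto_rpow_mul_exp_neg_mul_atTop_nhds_zero (2 * μ + 1) ε hε).const_mul
      (C + ‖s‖ * C)
    rw [mul_zero] at l
    refine squeeze_zero_norm' ?_ l
    filter_upwards [eventually_gt_atTop 0] with x hx
    have hb : ‖(besselEvenDeriv μ x : ℂ) + s * besselEven μ x‖ ≤ C + ‖s‖ * C := by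
      refine (norm_add_le _ _).trans ?_
      rw [norm_mul, Complex.norm_real, Complex.norm_real, Real.norm_eq_abs, Real.norm_eq_abs]
      have h1 := (hC x hx.le).1
      have h2 := (hC x hx.le).2
      gcongr
    simp only [f]
    rw [norm_mul, norm_mul, norm_exp_neg_add_I_mul, Complex.norm_real, Real.norm_eq_abs,
      abs_of_nonneg (by positivity)]
    calc Real.exp (-ε * x) * (x ^ (2 * μ + 1) * _)
        ≤ Real.exp (-ε * x) * (x ^ (2 * μ + 1) * (C + ‖s‖ * C)) := by gcongr
      _ = _ := by ring
  have hint := integral_Ioi_of_hasDerivAt_of_tendsto hf0 hd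
    ((hI1.const_mul _).sub (hI2.const_mul _)) hlim
  rw [integral_sub (hI1.const_mul _) (hI2.const_mul _), integral_const_mul,
    integral_const_mul] at hint
  simpa [f, Real.zero_rpow hp.ne', besselLaplace, besselLaplaceMoment] using hint

/-! ### Abelian limits of the Laplace transform -/

lemma integral_Ioi_eq_mul_integral_comp_mul (F : ℝ → ℂ) {T : ℝ} (hT : 0 < T) :
    ∫ x in Ioi (0 : ℝ), F x = T * ∫ y in Ioi (0 : ℝ), F (T * y) := by
  have hT' : (T : ℂ) ≠ 0 := by exact_mod_cast hT.ne'
  rw [integral_comp_mul_left_Ioi F 0 hT, mul_zero, Complex.real_smul, Complex.ofReal_inv,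
    mul_inv_cancel_left₀ hT']

lemma integral_ofReal_exp_neg_mul_rpow {s : ℝ} (hs : 0 < s) :
    ∫ y in Ioi (0 : ℝ), ((Real.exp (-y) * y ^ (s - 1) : ℝ) : ℂ) = Real.Gamma s := by
  rw [integral_complex_ofReal, Real.Gamma_eq_integral hs]

lemma continuousOn_exp_mul_rpow_mul_comp (T k : ℝ) {w : ℝ → ℝ} (hw : ContinuousOn w (Ioi 0)) :
    ContinuousOn (fun y : ℝ => Complex.exp (-((1 + T * Complex.I) * y)) *
      ((y ^ k * w y : ℝ) : ℂ)) (Ioi 0) := by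
  refine ContinuousOn.mul (by fun_prop) (Complex.continuous_ofReal.comp_continuousOn ?_)
  exact ContinuousOn.mul (fun x hx => (Real.continuousAt_rpow_const x k
    (Or.inl (ne_of_gt hx))).continuousWithinAt) hw

lemma norm_exp_mul_rpow_mul_comp_le {T k C y b : ℝ} (hy : 0 < y) (hb : |b| ≤ C) :
    ‖Complex.exp (-((1 + T * Complex.I) * y)) * ((y ^ k * b : ℝ) : ℂ)‖ ≤
      C * (y ^ k * Real.exp (-1 * y)) := by
  rw [norm_mul, Complex.norm_exp, Complex.norm_real, Real.norm_eq_abs, abs_mul,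
    abs_of_nonneg (by positivity : 0 ≤ y ^ k)]
  have : (-((1 + (T : ℂ) * Complex.I) * y)).re = -1 * y := by simp
  rw [this]
  calc Real.exp (-1 * y) * (y ^ k * |b|) ≤ Real.exp (-1 * y) * (y ^ k * C) := by gcongr
    _ = _ := by ring

/-- After the substitution `x = y / ε` this is dominated convergence to
`g_μ(0) ∫ exp (-y) y ^ (2 μ) dy`. -/
lemma tendsto_rpow_mul_besselLaplace_atTop {μ : ℝ} (hμ : -(1 / 2 : ℝ) < μ) :
    Tendsto (fun ε : ℝ => ((ε ^ (2 * μ + 1) : ℝ) : ℂ) * besselLaplace μ ε) atTop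
      (𝓝 ((besselEven μ 0 * Real.Gamma (2 * μ + 1) : ℝ) : ℂ)) := by
  obtain ⟨C, hC0, hC⟩ := exists_abs_besselEven_le hμ
  have hcont := continuous_besselEven hμ
  have hlim : ((besselEven μ 0 * Real.Gamma (2 * μ + 1) : ℝ) : ℂ) =
      ∫ y in Ioi (0 : ℝ), Complex.exp (-((1 + (0 : ℝ) * Complex.I) * y)) *
        ((y ^ (2 * μ) * besselEven μ (0 * y) : ℝ) : ℂ) := by
    rw [Complex.ofReal_mul, ← integral_ofReal_exp_neg_mul_rpow (by linarith), ← integral_const_mul]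
    congr 1
    funext y
    simp only [zero_mul, add_sub_cancel_right]
    push_cast
    rw [zero_mul, add_zero, one_mul]
    ring
  rw [hlim]
  have hDCT : Tendsto (fun ε : ℝ => ∫ y in Ioi (0 : ℝ),
      Complex.exp (-((1 + (ε⁻¹ : ℝ) * Complex.I) * y)) *
        ((y ^ (2 * μ) * besselEven μ (ε⁻¹ * y) : ℝ) : ℂ)) atTop
      (𝓝 (∫ y in Ioi (0 : ℝ), Complex.exp (-((1 + (0 : ℝ) * Complex.I) * y)) *
        ((y ^ (2 * μ) * besselEven μ (0 * y) : ℝ) : ℂ))) := by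
    refine tendsto_integral_filter_of_dominated_convergence
      (fun y => C * (y ^ (2 * μ) * Real.exp (-1 * y))) ?_ ?_ ?_ ?_
    · exact Eventually.of_forall fun ε => (continuousOn_exp_mul_rpow_mul_comp _ _
        (by fun_prop)).aestronglyMeasurable measurableSet_Ioi
    · filter_upwards [eventually_gt_atTop 0] with ε hε
      refine (ae_restrict_iff' measurableSet_Ioi).mpr (Eventually.of_forall fun y hy => ?_)
      have hy0 : 0 < y := hy
      exact norm_exp_mul_rpow_mul_comp_le hy0 (hC _ (by positivity)).1
    · exact (integrableOn_rpow_mul_exp (by linarith) one_pos).const_mul C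
    · refine Eventually.of_forall fun y => ?_
      have hc : Continuous fun d : ℝ => Complex.exp (-((1 + (d : ℝ) * Complex.I) * y)) *
          ((y ^ (2 * μ) * besselEven μ (d * y) : ℝ) : ℂ) := by fun_prop
      exact (hc.tendsto 0).comp tendsto_inv_atTop_zero
  refine hDCT.congr' ?_
  filter_upwards [eventually_gt_atTop 0] with ε hε
  rw [besselLaplace, integral_Ioi_eq_mul_integral_comp_mul (laplaceIntegrand μ ε)
    (inv_pos.mpr hε), ← mul_assoc, ← integral_const_mul]
  refine setIntegral_congr_fun measurableSet_Ioi fun y hy => ?_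
  have hy0 : 0 < y := hy
  have hεc : (ε : ℂ) ≠ 0 := by exact_mod_cast hε.ne'
  have e1 : (((ε : ℝ) : ℂ) + Complex.I) * ((ε⁻¹ * y : ℝ) : ℂ) =
      (1 + ((ε⁻¹ : ℝ) : ℂ) * Complex.I) * y := by
    push_cast
    field_simp
  have e2 : ε ^ (2 * μ + 1) * ε⁻¹ * (ε⁻¹ * y) ^ (2 * μ) = y ^ (2 * μ) := by
    rw [Real.mul_rpow (by positivity) hy0.le, Real.inv_rpow hε.le, Real.rpow_add_one hε.ne']
    have : ε ^ (2 * μ) ≠ 0 := (Real.rpow_pos_of_pos hε _).ne'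
    field_simp
  simp only [laplaceIntegrand]
  rw [e1, ← e2]
  push_cast
  ring

/-- The Riemann–Lebesgue lemma on the half line. For non-integrable `f` the integrals are all zero. -/
lemma tendsto_integral_exp_mul_atTop (f : ℝ → ℂ) :
    Tendsto (fun T : ℝ => ∫ y in Ioi (0 : ℝ), Complex.exp (-(2 * T * y * Complex.I)) * f y) atTop
      (𝓝 0) := by
  have h := (Real.tendsto_integral_exp_smul_cocompact (indicator (Ioi (0 : ℝ)) f)).comp
    ((tendsto_id.atTop_div_const Real.pi_pos).mono_right atTop_le_cocompact)
  refine h.congr fun T => ?_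
  simp only [Function.comp, id]
  rw [← integral_indicator measurableSet_Ioi]
  congr 1
  funext y
  by_cases hy : y ∈ Ioi (0 : ℝ)
  · rw [indicator_of_mem hy, indicator_of_mem hy, Circle.smul_def, Real.fourierChar_apply,
      smul_eq_mul]
    congr 2
    have : (Real.pi : ℂ) ≠ 0 := by exact_mod_cast Real.pi_ne_zero
    push_cast
    field_simp
  · rw [indicator_of_notMem hy, indicator_of_notMem hy, smul_zero]

/-- Abel's theorem for the Laplace transform: if `√x J_μ(x)` is asymptotic to `A cos x + B sin x`,
the transform of `x ^ μ J_μ(x)` blows up like `Γ(μ + 1 / 2) (A - i B) / (2 ε ^ (μ + 1 / 2))` as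
`ε → 0`. The resonant half of the oscillation gives the limit, the other half tends to `0` by the
Riemann–Lebesgue lemma, and the error term by dominated convergence. -/
lemma tendsto_rpow_mul_besselLaplace_zero {μ A B : ℝ} (hμ : -(1 / 2 : ℝ) < μ)
    (hAB : Tendsto (fun x => besselLiouville μ x - (A * Real.cos x + B * Real.sin x)) atTop
      (𝓝 0)) :
    Tendsto (fun ε : ℝ => ((ε ^ (μ + 1 / 2) : ℝ) : ℂ) * besselLaplace μ ε) (𝓝[>] 0)
      (𝓝 ((A - B * Complex.I) / 2 * Real.Gamma (μ + 1 / 2))) := by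
  obtain ⟨C, hC⟩ := exists_abs_besselLiouville_le hμ
  set R : ℝ → ℝ := fun x => besselLiouville μ x - (A * Real.cos x + B * Real.sin x) with hR
  set w : ℝ → ℂ := fun y => ((Real.exp (-y) * y ^ (μ - 1 / 2) : ℝ) : ℂ) with hw
  have hRb : ∀ x > 0, |R x| ≤ C + (|A| + |B|) := by
    intro x hx
    refine (abs_sub _ _).trans (add_le_add (hC x hx) ((abs_add_le _ _).trans ?_))
    rw [abs_mul, abs_mul]
    have h1 := Real.abs_cos_le_one x
    have h2 := Real.abs_sin_le_one x
    have h3 := abs_nonneg A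
    have h4 := abs_nonneg B
    nlinarith
  have hRc : ContinuousOn R (Ioi 0) :=
    (solvesBesselNormalForm_besselLiouville hμ).continuousOn.sub (by fun_prop)
  have hwi : IntegrableOn w (Ioi 0) := by
    have := (Real.GammaIntegral_convergent (by linarith : 0 < μ + 1 / 2)).ofReal (𝕜 := ℂ)
    rwa [show μ + 1 / 2 - 1 = μ - 1 / 2 by ring] at this
  have hwint : ∫ y in Ioi (0 : ℝ), w y = Real.Gamma (μ + 1 / 2) := by
    rw [← integral_ofReal_exp_neg_mul_rpow (by linarith), show μ + 1 / 2 - 1 = μ - 1 / 2 by ring]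
  have hRT : ∀ T > 0, ContinuousOn (fun y => R (T * y)) (Ioi 0) := fun T hT =>
    hRc.comp (by fun_prop) fun y hy => mul_pos hT hy
  have hbound : ∀ T : ℝ, T > 0 → ∀ᵐ y : ℝ ∂volume.restrict (Ioi (0 : ℝ)),
      ‖Complex.exp (-((1 + T * Complex.I) * y)) * ((y ^ (μ - 1 / 2) * R (T * y) : ℝ) : ℂ)‖ ≤
        (C + (|A| + |B|)) * (y ^ (μ - 1 / 2) * Real.exp (-1 * y)) := fun T hT =>
    (ae_restrict_iff' measurableSet_Ioi).mpr (Eventually.of_forall fun y hy =>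
      norm_exp_mul_rpow_mul_comp_le hy (hRb _ (mul_pos hT hy)))
  have hbi : IntegrableOn (fun y : ℝ => (C + (|A| + |B|)) * (y ^ (μ - 1 / 2) * Real.exp (-1 * y)))
      (Ioi 0) := (integrableOn_rpow_mul_exp (by linarith) one_pos).const_mul _
  have herr : Tendsto (fun T : ℝ => ∫ y in Ioi (0 : ℝ),
      Complex.exp (-((1 + T * Complex.I) * y)) * ((y ^ (μ - 1 / 2) * R (T * y) : ℝ) : ℂ)) atTop
      (𝓝 0) := by
    have h0 : (0 : ℂ) = ∫ y in Ioi (0 : ℝ), (0 : ℂ) := by simp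
    rw [h0]
    refine tendsto_integral_filter_of_dominated_convergence
      (fun y => (C + (|A| + |B|)) * (y ^ (μ - 1 / 2) * Real.exp (-1 * y))) ?_ ?_ hbi ?_
    · filter_upwards [eventually_gt_atTop 0] with T hT
      exact (continuousOn_exp_mul_rpow_mul_comp _ _ (hRT T hT)).aestronglyMeasurable
        measurableSet_Ioi
    · filter_upwards [eventually_gt_atTop 0] with T hT
      exact hbound T hT
    · refine (ae_restrict_iff' measurableSet_Ioi).mpr (Eventually.of_forall fun y hy => ?_)
      have hy0 : 0 < y := hy
      have l := (hAB.comp (tendsto_id.atTop_mul_const hy0)).abs.mul_const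
        (y ^ (μ - 1 / 2) * Real.exp (-1 * y))
      rw [abs_zero, zero_mul] at l
      refine squeeze_zero_norm (fun T => ?_) l
      exact norm_exp_mul_rpow_mul_comp_le hy0 le_rfl
  have hsum : Tendsto (fun T : ℝ => ∫ y in Ioi (0 : ℝ),
      Complex.exp (-((1 + T * Complex.I) * y)) *
        ((y ^ (μ - 1 / 2) * besselLiouville μ (T * y) : ℝ) : ℂ)) atTop
      (𝓝 ((A - B * Complex.I) / 2 * Real.Gamma (μ + 1 / 2))) := by
    have l := (((tendsto_integral_exp_mul_atTop w).const_mul ((A + B * Complex.I) / 2)).add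
      herr).const_add ((A - B * Complex.I) / 2 * Real.Gamma (μ + 1 / 2))
    rw [mul_zero, add_zero, add_zero] at l
    refine l.congr' ?_
    filter_upwards [eventually_gt_atTop 0] with T hT
    have hI2 : IntegrableOn (fun y : ℝ => Complex.exp (-(2 * T * y * Complex.I)) * w y)
        (Ioi 0) := by
      refine hwi.bdd_mul (c := 1) (by fun_prop) (Eventually.of_forall fun y => ?_)
      rw [Complex.norm_exp]
      simp
    have hI3 : IntegrableOn (fun y : ℝ => Complex.exp (-((1 + T * Complex.I) * y)) *
        ((y ^ (μ - 1 / 2) * R (T * y) : ℝ) : ℂ)) (Ioi 0) :=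
      hbi.mono' ((continuousOn_exp_mul_rpow_mul_comp _ _ (hRT T hT)).aestronglyMeasurable
        measurableSet_Ioi) (hbound T hT)
    have hI23 : IntegrableOn (fun y : ℝ => (A + B * Complex.I) / 2 *
        (Complex.exp (-(2 * T * y * Complex.I)) * w y) +
          Complex.exp (-((1 + T * Complex.I) * y)) * ((y ^ (μ - 1 / 2) * R (T * y) : ℝ) : ℂ))
        (Ioi 0) := (hI2.const_mul _).add hI3
    -- `exp (-iθ) (A cos θ + B sin θ) = (A - iB) / 2 + exp (-2iθ) (A + iB) / 2` with `θ = T y`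
    rw [← hwint, ← integral_const_mul, ← integral_const_mul,
      ← integral_add (hI2.const_mul _) hI3, ← integral_add (hwi.const_mul _) hI23]
    refine setIntegral_congr_fun measurableSet_Ioi fun y _ => ?_
    have e1 : Complex.exp (-((1 + T * Complex.I) * y)) = Complex.exp (-y) *
        (Complex.cos (T * y) - Complex.sin (T * y) * Complex.I) := by
      rw [show -((1 + T * Complex.I) * y) = (-y : ℂ) + (-(T * y : ℂ)) * Complex.I by ring,
        Complex.exp_add, Complex.exp_mul_I, Complex.cos_neg, Complex.sin_neg]
      ring
    have e2 : Complex.exp (-(2 * T * y * Complex.I)) =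
        (Complex.cos (T * y) - Complex.sin (T * y) * Complex.I) ^ 2 := by
      rw [show -(2 * T * y * Complex.I) = (2 : ℕ) * ((-(T * y : ℂ)) * Complex.I) by push_cast; ring,
        Complex.exp_nat_mul, Complex.exp_mul_I, Complex.cos_neg, Complex.sin_neg]
      ring
    simp only [hw, hR, e1, e2]
    push_cast
    have hcs := Complex.sin_sq_add_cos_sq (T * y)
    generalize Complex.cos (T * y) = p at hcs ⊢
    generalize Complex.sin (T * y) = q at hcs ⊢
    generalize (((y ^ (μ - 1 / 2) : ℝ)) : ℂ) = m
    generalize Complex.exp (-(y : ℂ)) = n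
    linear_combination (-(m * n) * (A - B * Complex.I) / 2) * hcs +
      (m * n / 2 * q ^ 2 * (A + B * Complex.I) - m * n * B * p * q) * Complex.I_sq
  refine (hsum.comp tendsto_inv_nhdsGT_zero).congr' ?_
  filter_upwards [self_mem_nhdsWithin] with ε hε'
  have hε : 0 < ε := hε'
  simp only [Function.comp]
  rw [besselLaplace, integral_Ioi_eq_mul_integral_comp_mul (laplaceIntegrand μ ε)
    (inv_pos.mpr hε), ← mul_assoc, ← integral_const_mul]
  refine setIntegral_congr_fun measurableSet_Ioi fun y hy => ?_
  have hy0 : 0 < y := hy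
  have hεc : (ε : ℂ) ≠ 0 := by exact_mod_cast hε.ne'
  have e1 : (((ε : ℝ) : ℂ) + Complex.I) * ((ε⁻¹ * y : ℝ) : ℂ) =
      (1 + ((ε⁻¹ : ℝ) : ℂ) * Complex.I) * y := by
    push_cast
    field_simp
  have e2 : y ^ (μ - 1 / 2) * (ε⁻¹ * y) ^ (μ + 1 / 2) =
      ε ^ (μ + 1 / 2) * ε⁻¹ * (ε⁻¹ * y) ^ (2 * μ) := by
    have h1 : y ^ (μ - 1 / 2) = ε ^ (μ - 1 / 2) * (ε⁻¹ * y) ^ (μ - 1 / 2) := by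
      rw [← Real.mul_rpow hε.le (by positivity), mul_inv_cancel_left₀ hε.ne']
    have h2 : ε ^ (μ + 1 / 2) = ε ^ (μ - 1 / 2) * ε := by
      rw [← Real.rpow_add_one hε.ne']
      ring_nf
    rw [h1, h2, show 2 * μ = (μ - 1 / 2) + (μ + 1 / 2) by ring,
      Real.rpow_add (by positivity) (μ - 1 / 2)]
    field_simp
  simp only [laplaceIntegrand, besselLiouville]
  rw [e1, ← mul_assoc (y ^ (μ - 1 / 2)), e2]
  push_cast
  ring

/-! ### Amplitude, phase and the uniform bound -/

/-- The exact evaluation `F(s) = g_μ(0) Γ(2 μ + 1) (1 + s²) ^ (-(μ + 1 / 2))` of the Laplace transform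
at `s = ε + i`, where `1 + s² = ε (ε + 2 i)`: the product below is constant by the differential
equation for `F`, and its value is read off as `ε → ∞`. -/
lemma rpow_mul_cpow_mul_besselLaplace {μ ε : ℝ} (hμ : -(1 / 2 : ℝ) < μ) (hε : 0 < ε) :
    ((ε ^ (μ + 1 / 2) : ℝ) : ℂ) * besselLaplace μ ε *
      ((ε : ℂ) + 2 * Complex.I) ^ ((μ + 1 / 2 : ℝ) : ℂ) =
      ((besselEven μ 0 * Real.Gamma (2 * μ + 1) : ℝ) : ℂ) := by
  set K : ℝ → ℂ := fun ε => ((ε ^ (μ + 1 / 2) : ℝ) : ℂ) * besselLaplace μ ε *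
      ((ε : ℂ) + 2 * Complex.I) ^ ((μ + 1 / 2 : ℝ) : ℂ)
  have hd : ∀ δ > 0, HasDerivAt K 0 δ := by
    intro δ hδ
    have hδ0 : δ ≠ 0 := ne_of_gt hδ
    have hz : (δ : ℂ) + 2 * Complex.I ∈ Complex.slitPlane := Or.inl (by simpa using hδ)
    have hz0 : (δ : ℂ) + 2 * Complex.I ≠ 0 := Complex.slitPlane_ne_zero hz
    have h1 := (Real.hasDerivAt_rpow_const (p := μ + 1 / 2) (Or.inl hδ0)).ofReal_comp
    have h2 : HasDerivAt (fun δ : ℝ => ((δ : ℂ) + 2 * Complex.I) ^ ((μ + 1 / 2 : ℝ) : ℂ))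
        (((μ + 1 / 2 : ℝ) : ℂ) * ((δ : ℂ) + 2 * Complex.I) ^ (((μ + 1 / 2 : ℝ) : ℂ) - 1) * 1) δ :=
      (((hasDerivAt_id (δ : ℂ)).add_const (2 * Complex.I)).cpow_const hz).comp_ofReal
    convert! (h1.mul (hasDerivAt_besselLaplace hμ hδ)).mul h2 using 1
    have heq := besselLaplace_equation hμ hδ
    have hs : 1 + ((δ : ℂ) + Complex.I) ^ 2 = δ * (δ + 2 * Complex.I) := by
      linear_combination Complex.I_sq
    rw [hs] at heq
    simp only [Pi.mul_apply]
    rw [Complex.cpow_sub _ _ hz0, Complex.cpow_one, show μ + 1 / 2 - 1 = μ - 1 / 2 by ring,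
      show (δ : ℝ) ^ (μ + 1 / 2) = δ ^ (μ - 1 / 2) * δ by
        rw [← Real.rpow_add_one hδ0]; ring_nf]
    generalize ((δ : ℂ) + 2 * Complex.I) ^ ((μ + 1 / 2 : ℝ) : ℂ) = W
    generalize (δ : ℝ) ^ (μ - 1 / 2) = m
    push_cast
    field_simp
    linear_combination (-2 * (m : ℂ) * W) * heq
  have hconst : ∀ δ > 0, K δ = K ε := fun δ hδ =>
    isOpen_Ioi.is_const_of_deriv_eq_zero (𝕜 := ℝ) (convex_Ioi 0).isPreconnected
      (fun y hy => (hd y hy).differentiableAt.differentiableWithinAt)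
      (fun y hy => (hd y hy).deriv) hδ hε
  have hlim : Tendsto K atTop (𝓝 ((besselEven μ 0 * Real.Gamma (2 * μ + 1) : ℝ) : ℂ)) := by
    have l1 : Tendsto (fun δ : ℝ => (1 + ((δ⁻¹ : ℝ) : ℂ) * (2 * Complex.I)) ^
        ((μ + 1 / 2 : ℝ) : ℂ)) atTop (𝓝 1) := by
      have hc : ContinuousAt (fun d : ℝ => (1 + (d : ℂ) * (2 * Complex.I)) ^
          ((μ + 1 / 2 : ℝ) : ℂ)) 0 :=
        ContinuousAt.cpow (by fun_prop) continuousAt_const (Or.inl (by simp))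
      have := hc.tendsto.comp tendsto_inv_atTop_zero
      simpa [Function.comp_def] using this
    have l := (tendsto_rpow_mul_besselLaplace_atTop hμ).mul l1
    rw [mul_one] at l
    refine l.congr' ?_
    filter_upwards [eventually_gt_atTop 0] with δ hδ
    have hδc : (δ : ℂ) ≠ 0 := by exact_mod_cast hδ.ne'
    have hne : (1 + ((δ⁻¹ : ℝ) : ℂ) * (2 * Complex.I)) ≠ 0 :=
      Complex.slitPlane_ne_zero (Or.inl (by simp))
    have e1 : (δ : ℂ) + 2 * Complex.I = (δ : ℂ) * (1 + ((δ⁻¹ : ℝ) : ℂ) * (2 * Complex.I)) := by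
      push_cast
      field_simp
    have e2 : ((δ : ℂ) + 2 * Complex.I) ^ ((μ + 1 / 2 : ℝ) : ℂ) =
        ((δ ^ (μ + 1 / 2) : ℝ) : ℂ) *
          (1 + ((δ⁻¹ : ℝ) : ℂ) * (2 * Complex.I)) ^ ((μ + 1 / 2 : ℝ) : ℂ) := by
      rw [e1, Complex.cpow_def_of_ne_zero (mul_ne_zero hδc hne), Complex.log_ofReal_mul hδ hne,
        add_mul, Complex.exp_add, ← Complex.cpow_def_of_ne_zero hne, Real.rpow_def_of_pos hδ]
      push_cast
      rfl
    have e3 : δ ^ (2 * μ + 1) = δ ^ (μ + 1 / 2) * δ ^ (μ + 1 / 2) := by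
      rw [← Real.rpow_add hδ]
      ring_nf
    simp only [K]
    rw [e2, e3]
    push_cast
    ring
  refine tendsto_nhds_unique (tendsto_const_nhds.congr' ?_) hlim
  filter_upwards [eventually_gt_atTop 0] with δ hδ
  exact (hconst δ hδ).symm

lemma two_mul_I_cpow (μ : ℝ) :
    (2 * Complex.I) ^ ((μ + 1 / 2 : ℝ) : ℂ) =
      ((2 ^ (μ + 1 / 2) : ℝ) : ℂ) *
        (Real.cos (besselPhase μ) + Real.sin (besselPhase μ) * Complex.I) := by
  have h2 : (2 * Complex.I) = ((2 : ℝ) : ℂ) * Complex.I := by norm_num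
  rw [h2, Complex.cpow_def_of_ne_zero (by simp), Complex.log_ofReal_mul two_pos Complex.I_ne_zero,
    Complex.log_I, add_mul, Complex.exp_add, Real.rpow_def_of_pos two_pos,
    show (Real.pi : ℂ) / 2 * Complex.I * ((μ + 1 / 2 : ℝ) : ℂ) =
      (besselPhase μ : ℂ) * Complex.I by
        rw [besselPhase]; push_cast; ring, Complex.exp_mul_I]
  push_cast
  rfl

/-- Legendre's duplication formula, in the form that gives the amplitude `√(2 / π)`. -/
lemma besselEven_zero_mul_Gamma {μ : ℝ} (hμ : -(1 / 2 : ℝ) < μ) :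
    besselEven μ 0 * Real.Gamma (2 * μ + 1) =
      √(2 / Real.pi) / 2 * Real.Gamma (μ + 1 / 2) * 2 ^ (μ + 1 / 2) := by
  have h := Real.Gamma_mul_Gamma_add_half (μ + 1 / 2)
  rw [show μ + 1 / 2 + 1 / 2 = μ + 1 by ring, show 2 * (μ + 1 / 2) = 2 * μ + 1 by ring,
    show 1 - (2 * μ + 1) = -μ + -μ by ring, Real.rpow_add two_pos] at h
  have hG : Real.Gamma (μ + 1) ≠ 0 := (Real.Gamma_pos_of_pos (by linarith)).ne'
  have hpi : √Real.pi ≠ 0 := (Real.sqrt_pos.mpr Real.pi_pos).ne'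
  have h2 : (2 : ℝ) ^ μ ≠ 0 := (Real.rpow_pos_of_pos two_pos _).ne'
  have hs : √2 * √2 = (2 : ℝ) := Real.mul_self_sqrt (by norm_num)
  rw [besselEven_zero, Real.sqrt_div (by norm_num), Real.rpow_add two_pos, ← Real.sqrt_eq_rpow]
  rw [Real.rpow_neg two_pos.le] at h ⊢
  generalize Real.Gamma (μ + 1 / 2) = G at h ⊢
  field_simp at h ⊢
  linear_combination (-(2 : ℝ)) * h - G * (2 ^ μ) ^ 2 * Real.Gamma (μ + 1) * hs

/-- The leading asymptotics of `√x J_μ(x)` and of its derivative. -/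
lemma tendsto_besselLiouville_sub_cos {μ : ℝ} (hμ : -(1 / 2 : ℝ) < μ) :
    Tendsto (fun x => besselLiouville μ x - √(2 / Real.pi) * Real.cos (x - besselPhase μ)) atTop
        (𝓝 0) ∧
      Tendsto (fun x => besselLiouvilleDeriv μ x + √(2 / Real.pi) * Real.sin (x - besselPhase μ))
        atTop (𝓝 0) := by
  obtain ⟨A, B, hA, hB⟩ := (solvesBesselNormalForm_besselLiouville hμ).exists_asymptotics
  have l1 : Tendsto (fun ε : ℝ => ((ε : ℂ) + 2 * Complex.I) ^ ((μ + 1 / 2 : ℝ) : ℂ)) (𝓝[>] 0)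
      (𝓝 ((2 * Complex.I) ^ ((μ + 1 / 2 : ℝ) : ℂ))) := by
    have hc : ContinuousAt (fun ε : ℝ => ((ε : ℂ) + 2 * Complex.I) ^ ((μ + 1 / 2 : ℝ) : ℂ)) 0 :=
      ContinuousAt.cpow (by fun_prop) continuousAt_const (Or.inr (by simp))
    have := hc.tendsto
    simp only [Complex.ofReal_zero, zero_add] at this
    exact this.mono_left nhdsWithin_le_nhds
  have l := (tendsto_rpow_mul_besselLaplace_zero hμ hA).mul l1
  have heq : (A - B * Complex.I) / 2 * Real.Gamma (μ + 1 / 2) *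
      (2 * Complex.I) ^ ((μ + 1 / 2 : ℝ) : ℂ) =
      ((besselEven μ 0 * Real.Gamma (2 * μ + 1) : ℝ) : ℂ) := by
    refine tendsto_nhds_unique l (tendsto_const_nhds.congr' ?_)
    filter_upwards [self_mem_nhdsWithin] with ε hε
    exact (rpow_mul_cpow_mul_besselLaplace hμ hε).symm
  rw [two_mul_I_cpow, besselEven_zero_mul_Gamma hμ] at heq
  set c := √(2 / Real.pi)
  set ω := besselPhase μ
  have hG : (Real.Gamma (μ + 1 / 2) : ℂ) ≠ 0 := by
    exact_mod_cast (Real.Gamma_pos_of_pos (by linarith)).ne'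
  have h2 : ((2 ^ (μ + 1 / 2) : ℝ) : ℂ) ≠ 0 := by
    exact_mod_cast (Real.rpow_pos_of_pos two_pos _).ne'
  have hmul : (A - B * Complex.I) * (Real.cos ω + Real.sin ω * Complex.I) = (c : ℂ) := by
    have e : ((A - B * Complex.I) * (Real.cos ω + Real.sin ω * Complex.I) - c) *
        (Real.Gamma (μ + 1 / 2) * ((2 ^ (μ + 1 / 2) : ℝ) : ℂ)) = 0 := by
      rw [Complex.ofReal_mul, Complex.ofReal_mul, Complex.ofReal_div, Complex.ofReal_ofNat] at heq
      linear_combination 2 * heq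
    exact sub_eq_zero.mp ((mul_eq_zero.mp e).resolve_right (mul_ne_zero hG h2))
  have hre := congrArg Complex.re hmul
  have him := congrArg Complex.im hmul
  simp only [Complex.mul_re, Complex.mul_im, Complex.sub_re, Complex.sub_im, Complex.add_re,
    Complex.add_im, Complex.ofReal_re, Complex.ofReal_im, Complex.I_re, Complex.I_im] at hre him
  have hcs := Real.sin_sq_add_cos_sq ω
  have hAc : A = c * Real.cos ω := by
    linear_combination Real.cos ω * hre + Real.sin ω * him - A * hcs
  have hBc : B = c * Real.sin ω := by
    linear_combination Real.sin ω * hre - Real.cos ω * him - B * hcs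
  constructor
  · refine hA.congr fun x => ?_
    rw [Real.cos_sub, hAc, hBc]
    ring
  · refine hB.congr fun x => ?_
    rw [Real.sin_sub, hAc, hBc]
    ring

lemma rpow_mul_abs_besselJ_sub_besselTwoTerm_le {μ x : ℝ} (hμ : -(1 / 2 : ℝ) < μ) (hx : 0 ≤ x) :
    x ^ (5 / 2 : ℝ) * |besselJ μ x - besselTwoTerm μ x| ≤
      |μ ^ 2 - 1 / 4| / Real.pi * (4 / 5 * |μ ^ 2 - 1 / 4| + √(2 / Real.pi)) := by
  have hpi := Real.pi_pos
  rcases hx.eq_or_lt with rfl | hx0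
  · rw [Real.zero_rpow (by norm_num), zero_mul]
    positivity
  obtain ⟨hu, hv⟩ := tendsto_besselLiouville_sub_cos hμ
  have hc : 0 < √(2 / Real.pi) := Real.sqrt_pos.mpr (by positivity)
  have hmain := (solvesBesselNormalForm_besselLiouville hμ).abs_sub_two_term_le hc hu hv
    (fun ha => tendsto_energy_besselLiouville_zero (by nlinarith)) hx0
  have e1 : x ^ (5 / 2 : ℝ) = x ^ 2 * √x := by
    rw [Real.sqrt_eq_rpow, ← Real.rpow_natCast, ← Real.rpow_add hx0]
    norm_num
  have e2 : √x * √(2 / (Real.pi * x)) = √(2 / Real.pi) := by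
    rw [← Real.sqrt_mul hx]
    congr 1
    field_simp
  have e3 : √x * |besselJ μ x - besselTwoTerm μ x| =
      |besselLiouville μ x - √(2 / Real.pi) * (Real.cos (x - besselPhase μ) -
        (μ ^ 2 - 1 / 4) * (Real.sin (x - besselPhase μ) / (2 * x)))| := by
    have habs : ∀ y : ℝ, √x * |y| = |√x * y| := fun y => by
      rw [abs_mul, abs_of_nonneg (Real.sqrt_nonneg x)]
    rw [habs, mul_sub, sqrt_mul_besselJ hx0, besselTwoTerm, ← mul_assoc, e2]
  rw [e1, mul_assoc, e3]
  set β := |μ ^ 2 - 1 / 4|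
  have hβ : 0 ≤ β := abs_nonneg _
  set c := √(2 / Real.pi)
  have hc1 : c ≤ 1 := by
    refine Real.sqrt_le_one.mpr ?_
    rw [div_le_one hpi]
    linarith [Real.pi_gt_three]
  calc x ^ 2 * _ ≤ x ^ 2 * ((β * c / 4 + 289 / 1152 * (β ^ 2 * c)) * (1 / x ^ 2)) := by gcongr
    _ = β * c / 4 + 289 / 1152 * (β ^ 2 * c) := by field_simp
    _ ≤ β * c * (1 / Real.pi) + 4 / 5 * (1 / Real.pi) * (β ^ 2 * 1) := by
        have h1 : (1 : ℝ) / 4 ≤ 1 / Real.pi := one_div_le_one_div_of_le hpi Real.pi_le_four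
        have h2 : (289 : ℝ) / 1152 ≤ 4 / 5 * (1 / Real.pi) := by
          rw [mul_one_div, le_div_iff₀ hpi]
          linarith [Real.pi_lt_d2]
        rw [div_eq_mul_one_div (β * c)]
        gcongr
    _ = _ := by ring

theorem proposition1 (μ : ℝ) (hμ : -(1 / 2 : ℝ) < μ) :
    BddAbove ((fun x : ℝ => x ^ (5 / 2 : ℝ) * |besselJ μ x - besselTwoTerm μ x|) '' Set.Ici 0) ∧
    sSup ((fun x : ℝ => x ^ (5 / 2 : ℝ) * |besselJ μ x - besselTwoTerm μ x|) '' Set.Ici 0) ≤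
      |μ ^ 2 - 1 / 4| / Real.pi *
        (4 / 5 * |μ ^ 2 - 1 / 4| + Real.sqrt (2 / Real.pi)) := by
  have hbound : ∀ y ∈ (fun x : ℝ => x ^ (5 / 2 : ℝ) * |besselJ μ x - besselTwoTerm μ x|) ''
      Set.Ici 0, y ≤ |μ ^ 2 - 1 / 4| / Real.pi *
        (4 / 5 * |μ ^ 2 - 1 / 4| + Real.sqrt (2 / Real.pi)) := by
    rintro _ ⟨x, hx, rfl⟩
    exact rpow_mul_abs_besselJ_sub_besselTwoTerm_le hμ hx
  exact ⟨⟨_, hbound⟩, csSup_le (Set.nonempty_Ici.image _) hbound⟩
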